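/- Let $k$ be an algebraically closed field of characteristic zero and let $l\ge 1$, $m\ge 2$ be integers. Vectors are row vectors; $G=\mathrm{SL}_l(k)$. Let $\mathrm{Rep}(A_l)$ be the space of representations $A$ of the linear quiver $1\to2\to\cdots\to l$ of dimension vector $(1,2,\dots,l)$, so the arrow $i\to i+1$ is an $i\times(i+1)$ matrix, and $\mathrm{Rep}(A_l^\vee)$ the space of representations $\check A$ of the opposite quiver of the same dimension vector. All quotients below are categorical quotients $X/\Gamma=\operatorname{Spec}k[X]^{\Gamma}$. Put $\mathrm{SL}_\gamma=\prod_{i=1}^{l-1}\mathrm{SL}_i$, acting by base change at the vertices $1,\dots,l-1$, and $$\mathcal A=\mathrm{Rep}(A_l)/\mathrm{SL}_\gamma,\qquad \check{\mathcal A}=\mathrm{Rep}(A_l^\vee)/\mathrm{SL}_\gamma .$$ Base change at the vertex $l$ gives a right action $A\cdot g$ of $G$ on $\mathcal A$ and a left action $g\cdot\check A$ on $\check{\mathcal A}$. Define $$Z_{l,l}^m=(\mathcal A\times G^m\times\check{\mathcal A})/(G\times G),\qquad X_{2,2}=(\mathcal A^2\times\check{\mathcal A}^2)/G,$$ where $(a,b)\in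 G\times G$ acts by $(A,g_1,\dots,g_m,\check A)\mapsto(Aa^{-1},ag_1b^{-1},\dots,ag_mb^{-1},b\check A)$ and $g\in G$ acts by $(A_1,A_2,\check A_1,\check A_2)\mapsto(A_1g^{-1},A_2g^{-1},g\check A_1,g\check A_2)$. Let $A(p_i)$ (an $i\times l$ matrix) and $\check A(\check p_i)$ (an $l\times i$ matrix) be the products of matrices along the path from $i$ to $l$, respectively from $l$ to $i$. A pair $(A_1,A_2)$ is generic if $\begin{pmatrix}A_1(p_i)\\A_2(p_j)\end{pmatrix}$ has full rank for all $i,j\ge1$ with $i+j=l$; a pair $(\check A_1,\check A_2)$ is generic if $\begin{pmatrix}\check A_1(\check p_i)&\check A_2(\check p_j)\end{pmatrix}$ has full rank for all such $i,j$; a pair $(A,\check A)$ is generic if $A(p_i)\check A(\check p_i)$ has full rank for $1\le i\le l-1$. Let $X_{2,2}^\circ\subset X_{2,2}$ be the open subset where $(A_1,A_2)$, $(A_1,\check A_2)$, $(A_2,\check A_1)$, $(\check A_2,\check A_1)$ are all generic, and $X_{2,2}^{(m)}\subset X_{2,2}$ the open subset where $(A_1,\check A_2)$ and $(A_2,\check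 A_1)$ are generic if $m$ is even, and where $(A_1,A_2)$ and $(\check A_2,\check A_1)$ are generic if $m$ is odd. Write $g_{[n]}=g_1g_2^{-1}g_3\cdots g_n^{(-1)^{n-1}}$ and $g_{\overleftarrow{[n]}}=g_n^{(-1)^{n-1}}\cdots g_3g_2^{-1}g_1$. For $2\le n\le m$ let $\pi_n:Z_{l,l}^m\to X_{2,2}$ be the morphism induced by $$(A,g_1,\dots,g_m,\check A)\mapsto\begin{cases}(Ag_{[n-1]},\,Ag_n,\,g_{\overleftarrow{[n]}}\check A,\,\check A)& n\text{ even},\\(Ag_{[n-1]},\,A,\,g_{\overleftarrow{[n]}}\check A,\,g_n\check A)& n\text{ odd},\end{cases}$$ and let $(Z_{l,l}^m)^\circ_\pi\subset Z_{l,l}^m$ be the open subset where $(Ag_{[n]},A)$ and $(\check A,g_{\overleftarrow{[n]}}\check A)$ are generic for every even $n\in[2,m-1]$, and $(Ag_{[n]},\check A)$ and $(A,g_{\overleftarrow{[n]}}\check A)$ are generic for every odd $n\in[1,m-1]$. **Lemma.** The morphism $\pi=(\pi_2,\dots,\pi_m):Z_{l,l}^m\to(X_{2,2})^{m-1}$ maps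 the open set $(Z_{l,l}^m)^\circ_\pi$ into the open set $(X_{2,2}^\circ)^{m-2}\times X_{2,2}^{(m)}$ (the last factor being the target of $\pi_m$), and the restriction $$(Z_{l,l}^m)^\circ_\pi\longrightarrow(X_{2,2}^\circ)^{m-2}\times X_{2,2}^{(m)}$$ is a closed embedding. -/

import Mathlib

open CategoryTheory AlgebraicGeometry Matrix

universe u

noncomputable section

namespace FlaggedKronecker

/-! ### Affine varieties through their regular functions -/

/-- An affine variety over `k`, given by its coordinate algebra, realised as an algebra of
`k`-valued functions on a set `P`. For a closed subset of an affine space, `P` is the set of its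
`k`-points and the algebra consists of the polynomial functions. A categorical quotient `Y / Γ` is
kept on the set `P` of `Y`, the algebra being cut down to the invariants, so that an element of `P`
stands for its image in the quotient. -/
abbrev AffVar (k P : Type u) [Field k] : Type u := Subalgebra k (P → k)

section AffVar

variable {k P Q R : Type u} [Field k]

/-- The scheme `Spec k[X]`. -/
def spec (X : AffVar k P) : Scheme.{u} := Spec (CommRingCat.of X)

/-- The principal open subscheme `f ≠ 0` of `Spec k[X]`. -/
def principal (X : AffVar k P) (f : X) : (spec X).Opens :=
  (PrimeSpectrum.basicOpen f : TopologicalSpace.Opens (PrimeSpectrum X))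

/-- A morphism: a map on points along which regular functions pull back to regular functions. -/
structure Mor (X : AffVar k P) (Y : AffVar k Q) where
  map : P → Q
  regular : ∀ f ∈ Y, (fun x => f (map x)) ∈ X

/-- The comorphism `k[Y] → k[X]`. -/
def Mor.comorphism {X : AffVar k P} {Y : AffVar k Q} (φ : Mor X Y) : Y →ₐ[k] X where
  toFun f := ⟨fun x => f.1 (φ.map x), φ.regular f.1 f.2⟩
  map_one' := rfl
  map_mul' _ _ := rfl
  map_zero' := rfl
  map_add' _ _ := rfl
  commutes' _ := rfl

/-- The morphism of schemes `Spec k[X] ⟶ Spec k[Y]`. -/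
def Mor.spec {X : AffVar k P} {Y : AffVar k Q} (φ : Mor X Y) :
    FlaggedKronecker.spec X ⟶ FlaggedKronecker.spec Y :=
  Spec.map (CommRingCat.ofHom φ.comorphism.toRingHom)

/-- The variety whose regular functions are the polynomials in the coordinate functions `c i`. -/
def coordVar {ι : Type} (c : ι → P → k) : AffVar k P := Algebra.adjoin k (Set.range c)

/-- The product of two affine varieties; its algebra is `k[X] ⊗ k[Y]`, as functions on pairs. -/
def prodVar (X : AffVar k P) (Y : AffVar k Q) : AffVar k (P × Q) :=
  Algebra.adjoin k
    ({F | ∃ f ∈ X, F = fun p => f p.1} ∪ {F | ∃ f ∈ Y, F = fun p => f p.2})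

/-- The power `X ^ ι` of an affine variety. -/
def powVar (ι : Type) (X : AffVar k P) : AffVar k (ι → P) :=
  Algebra.adjoin k {F | ∃ i, ∃ f ∈ X, F = fun p => f (p i)}

/-- The categorical quotient `X / Γ = Spec k[X]^Γ`, where `γ : Γ` acts on points by `ρ γ`. -/
def quotVar (X : AffVar k P) {Γ : Type u} (ρ : Γ → P → P) : AffVar k P where
  carrier := {f | f ∈ X ∧ ∀ γ x, f (ρ γ x) = f x}
  mul_mem' := fun {a b} ha hb => ⟨X.mul_mem ha.1 hb.1, fun γ x => by simp [ha.2, hb.2]⟩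
  add_mem' := fun {a b} ha hb => ⟨X.add_mem ha.1 hb.1, fun γ x => by simp [ha.2, hb.2]⟩
  algebraMap_mem' := fun r => ⟨X.algebraMap_mem r, fun _ _ => rfl⟩

theorem mem_quotVar {X : AffVar k P} {Γ : Type u} {ρ : Γ → P → P} {f : P → k} :
    f ∈ quotVar X ρ ↔ f ∈ X ∧ ∀ γ x, f (ρ γ x) = f x := Iff.rfl

theorem coord_mem {ι : Type} (c : ι → P → k) (i : ι) : c i ∈ coordVar c :=
  Algebra.subset_adjoin ⟨i, rfl⟩

theorem fst_mem {X : AffVar k P} {Y : AffVar k Q} {f : P → k} (hf : f ∈ X) :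
    (fun p : P × Q => f p.1) ∈ prodVar X Y :=
  Algebra.subset_adjoin (Or.inl ⟨f, hf, rfl⟩)

theorem snd_mem {X : AffVar k P} {Y : AffVar k Q} {f : Q → k} (hf : f ∈ Y) :
    (fun p : P × Q => f p.2) ∈ prodVar X Y :=
  Algebra.subset_adjoin (Or.inr ⟨f, hf, rfl⟩)

/-- A regular function on a product is a finite sum of products of regular functions. -/
theorem mem_prodVar_iff {X : AffVar k P} {Y : AffVar k Q} {F : P × Q → k} :
    F ∈ prodVar X Y ↔ ∃ (n : ℕ) (a : Fin n → X) (b : Fin n → Y),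
      ∀ p, F p = ∑ i, (a i).1 p.1 * (b i).1 p.2 := by
  constructor
  · intro h
    let α : X →ₐ[k] (P × Q → k) :=
      { toFun := fun f p => f.1 p.1, map_one' := rfl, map_mul' := fun _ _ => rfl
        map_zero' := rfl, map_add' := fun _ _ => rfl, commutes' := fun _ => rfl }
    let β : Y →ₐ[k] (P × Q → k) :=
      { toFun := fun f p => f.1 p.2, map_one' := rfl, map_mul' := fun _ _ => rfl
        map_zero' := rfl, map_add' := fun _ _ => rfl, commutes' := fun _ => rfl }
    let θ := Algebra.TensorProduct.lift α β (fun _ _ => Commute.all _ _)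
    have hF : F ∈ θ.range := by
      refine (Algebra.adjoin_le ?_ : prodVar X Y ≤ _) h
      rintro _ (⟨f, hf, rfl⟩ | ⟨f, hf, rfl⟩)
      · refine ⟨(⟨f, hf⟩ : X) ⊗ₜ[k] 1, ?_⟩
        change α ⟨f, hf⟩ * β 1 = _
        rw [map_one, mul_one]; rfl
      · refine ⟨1 ⊗ₜ[k] (⟨f, hf⟩ : Y), ?_⟩
        change α 1 * β ⟨f, hf⟩ = _
        rw [map_one, one_mul]; rfl
    obtain ⟨t, rfl⟩ := hF
    obtain ⟨n, a, b, rfl⟩ := TensorProduct.exists_sum_tmul_eq t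
    refine ⟨n, a, b, fun p => ?_⟩
    have : θ (∑ i, a i ⊗ₜ[k] b i) = ∑ i, α (a i) * β (b i) := by
      rw [map_sum]; rfl
    change θ (∑ i, a i ⊗ₜ[k] b i) p = _
    rw [this, Finset.sum_apply]; rfl
  · rintro ⟨n, a, b, h⟩
    have : F = ∑ i, (fun p : P × Q => (a i).1 p.1) * (fun p => (b i).1 p.2) := by
      ext p; simp [h, Finset.sum_apply]
    rw [this]
    exact (prodVar X Y).sum_mem fun i _ =>
      (prodVar X Y).mul_mem (fst_mem (a i).2) (snd_mem (b i).2)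

theorem swap_mem {X : AffVar k P} {Y : AffVar k Q} {F : P × Q → k} (h : F ∈ prodVar X Y) :
    (fun p : Q × P => F (p.2, p.1)) ∈ prodVar Y X := by
  obtain ⟨n, a, b, h⟩ := mem_prodVar_iff.1 h
  exact mem_prodVar_iff.2 ⟨n, b, a, fun p => by simp [h, mul_comm]⟩

/-- Taking invariants of one factor commutes with the product. -/
theorem mem_quot_prod {X : AffVar k P} {Y : AffVar k Q} {Γ : Type u} {ρ : Γ → P → P}
    {F : P × Q → k} (h : F ∈ prodVar X Y) (hF : ∀ γ x y, F (ρ γ x, y) = F (x, y)) :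
    F ∈ prodVar (quotVar X ρ) Y := by
  obtain ⟨n, a, b, hab⟩ := mem_prodVar_iff.1 h
  let sl : P → (Q → k) := fun x y => F (x, y)
  have hsl : ∀ x, sl x = ∑ i, (a i).1 x • (b i).1 := by
    intro x; ext y; simp [sl, hab, Finset.sum_apply]
  let W : Submodule k (Q → k) := Submodule.span k (Set.range sl)
  have hW : W ≤ Submodule.span k (Set.range fun i => (b i).1) := by
    refine Submodule.span_le.2 ?_
    rintro _ ⟨x, rfl⟩
    rw [hsl]
    exact Submodule.sum_mem _ fun i _ =>
      Submodule.smul_mem _ _ (Submodule.subset_span ⟨i, rfl⟩)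
  have hWY : W ≤ Subalgebra.toSubmodule Y := by
    refine hW.trans (Submodule.span_le.2 ?_)
    rintro _ ⟨i, rfl⟩
    exact (b i).2
  have : FiniteDimensional k (Submodule.span k (Set.range fun i => (b i).1)) :=
    FiniteDimensional.span_of_finite k (Set.finite_range _)
  have : FiniteDimensional k W := Submodule.finiteDimensional_of_le hW
  let w := Module.finBasis k W
  choose lam hlam using fun j => LinearMap.exists_extend (w.coord j)
  have hc : ∀ j x, lam j (sl x) = w.repr ⟨sl x, Submodule.subset_span ⟨x, rfl⟩⟩ j := by
    intro j x
    rw [← Module.Basis.coord_apply, ← hlam j]; rfl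
  refine mem_prodVar_iff.2 ⟨_, fun j => ⟨fun x => lam j (sl x), mem_quotVar.2 ⟨?_, ?_⟩⟩,
    fun j => ⟨(w j).1, hWY (w j).2⟩, ?_⟩
  · have : (fun x => lam j (sl x)) = ∑ i, lam j (b i).1 • (a i).1 := by
      ext x; simp [hsl, Finset.sum_apply, mul_comm]
    rw [this]
    exact X.sum_mem fun i _ => X.smul_mem (a i).2 _
  · intro γ x
    have : sl (ρ γ x) = sl x := funext fun y => hF γ x y
    simp only [this]
  · rintro ⟨x, y⟩
    have h1 := congrArg (fun v : W => v.1 y)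
      (w.sum_repr ⟨sl x, Submodule.subset_span ⟨x, rfl⟩⟩)
    simp only [AddSubmonoidClass.coe_finsetSum, Finset.sum_apply, Submodule.coe_smul,
      Pi.smul_apply, smul_eq_mul] at h1
    simp only [hc]
    exact h1.symm

theorem mem_prod_quot {X : AffVar k P} {Y : AffVar k Q} {Δ : Type u} {σ : Δ → Q → Q}
    {F : P × Q → k} (h : F ∈ prodVar X Y) (hF : ∀ δ x y, F (x, σ δ y) = F (x, y)) :
    F ∈ prodVar X (quotVar Y σ) :=
  swap_mem (mem_quot_prod (swap_mem h) fun δ y x => hF δ x y)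

theorem mem_quot_prod_quot {X : AffVar k P} {Y : AffVar k Q} {Γ Δ : Type u} {ρ : Γ → P → P}
    {σ : Δ → Q → Q} {F : P × Q → k} (h : F ∈ prodVar X Y)
    (hX : ∀ γ x y, F (ρ γ x, y) = F (x, y)) (hY : ∀ δ x y, F (x, σ δ y) = F (x, y)) :
    F ∈ prodVar (quotVar X ρ) (quotVar Y σ) :=
  mem_prod_quot (mem_quot_prod h hX) hY

/-- A determinant of regular functions is regular. -/
theorem det_mem {X : AffVar k P} {n : Type} [Fintype n] [DecidableEq n]
    {M : P → Matrix n n k} (h : ∀ i j, (fun x => M x i j) ∈ X) : (fun x => (M x).det) ∈ X := by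
  have : (fun x => (M x).det) =
      ∑ σ : Equiv.Perm n, (Equiv.Perm.sign σ : ℤ) • ∏ i, (fun x => M x (σ i) i) := by
    ext x
    simp [Matrix.det_apply, Finset.sum_apply, Finset.prod_apply, Units.smul_def]
  rw [this]
  exact X.sum_mem fun σ _ => X.zsmul_mem (X.prod_mem fun i _ => h _ _) _

theorem mul_entry_mem {X : AffVar k P} {a b c : Type} [Fintype b] {M : P → Matrix a b k}
    {N : P → Matrix b c k} (hM : ∀ i j, (fun x => M x i j) ∈ X)
    (hN : ∀ i j, (fun x => N x i j) ∈ X) (i : a) (j : c) :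
    (fun x => (M x * N x) i j) ∈ X := by
  have : (fun x => (M x * N x) i j) = ∑ t, (fun x => M x i t) * (fun x => N x t j) := by
    ext x; simp [Matrix.mul_apply, Finset.sum_apply]
  rw [this]
  exact X.sum_mem fun t _ => X.mul_mem (hM _ _) (hN _ _)

namespace Mor

variable {X : AffVar k P} {Y : AffVar k Q} {Z : AffVar k R}

theorem coordVar_regular {ι : Type} {c : ι → Q → k} {φ : P → Q}
    (h : ∀ i, (fun x => c i (φ x)) ∈ X) : ∀ F ∈ coordVar c, (fun x => F (φ x)) ∈ X := by
  intro F hF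
  refine Algebra.adjoin_induction (p := fun F _ => (fun x => F (φ x)) ∈ X) ?_ ?_ ?_ ?_ hF
  · rintro _ ⟨i, rfl⟩; exact h i
  · intro r; exact X.algebraMap_mem r
  · intro _ _ _ _ h1 h2; exact X.add_mem h1 h2
  · intro _ _ _ _ h1 h2; exact X.mul_mem h1 h2

def comp (ψ : Mor Y Z) (φ : Mor X Y) : Mor X Z where
  map x := ψ.map (φ.map x)
  regular f hf := φ.regular _ (ψ.regular f hf)

def fst (X : AffVar k P) (Y : AffVar k Q) : Mor (prodVar X Y) X :=
  ⟨Prod.fst, fun _ hf => fst_mem hf⟩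

def snd (X : AffVar k P) (Y : AffVar k Q) : Mor (prodVar X Y) Y :=
  ⟨Prod.snd, fun _ hf => snd_mem hf⟩

def pair (φ : Mor X Y) (ψ : Mor X Z) : Mor X (prodVar Y Z) where
  map x := (φ.map x, ψ.map x)
  regular F hF := by
    obtain ⟨n, a, b, h⟩ := mem_prodVar_iff.1 hF
    have : (fun x => F (φ.map x, ψ.map x)) =
        ∑ i, (fun x => (a i).1 (φ.map x)) * (fun x => (b i).1 (ψ.map x)) := by
      ext x; simp [h, Finset.sum_apply]
    rw [this]
    exact X.sum_mem fun i _ => X.mul_mem (φ.regular _ (a i).2) (ψ.regular _ (b i).2)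

def proj (ι : Type) (X : AffVar k P) (i : ι) : Mor (powVar ι X) X :=
  ⟨fun x => x i, fun f hf => Algebra.subset_adjoin ⟨i, f, hf, rfl⟩⟩

def lift {ι : Type} (φ : ι → Mor X Y) : Mor X (powVar ι Y) where
  map x i := (φ i).map x
  regular F hF := by
    refine Algebra.adjoin_induction
      (p := fun F _ => (fun x => F (fun i => (φ i).map x)) ∈ X) ?_ ?_ ?_ ?_ hF
    · rintro _ ⟨i, f, hf, rfl⟩; exact (φ i).regular f hf
    · intro r; exact X.algebraMap_mem r
    · intro _ _ _ _ h1 h2; exact X.add_mem h1 h2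
    · intro _ _ _ _ h1 h2; exact X.mul_mem h1 h2

/-- The morphism of categorical quotients induced by a morphism that sends orbits into orbits. -/
def quotMap {Γ Δ : Type u} {ρ : Γ → P → P} {σ : Δ → Q → Q} (φ : Mor X Y)
    (h : ∀ γ x, ∃ δ, φ.map (ρ γ x) = σ δ (φ.map x)) : Mor (quotVar X ρ) (quotVar Y σ) where
  map := φ.map
  regular f hf := mem_quotVar.2 ⟨φ.regular f hf.1, fun γ x => by
    obtain ⟨δ, hδ⟩ := h γ x
    simp only [hδ, hf.2]⟩

end Mor

end AffVar

/-! ### Flags -/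

section Flags

variable (k : Type u) [Field k] (l : ℕ)

/-- Representations of the linear quiver `1 → 2 → ⋯ → l` with dimension vector `(1, 2, …, l)`.
Vectors are rows, so the arrow `i → i + 1` carries an `i × (i + 1)` matrix. (A vertex `0`
with the zero space is added for convenience; its matrix is empty.) -/
abbrev Flag : Type u := (i : Fin l) → Matrix (Fin i) (Fin (i + 1)) k

/-- Representations of the opposite quiver: the arrow `i + 1 → i` carries an `(i + 1) × i`
matrix. -/
abbrev DualFlag : Type u := (i : Fin l) → Matrix (Fin (i + 1)) (Fin i) k

/-- The group `SL_1 × ⋯ × SL_l` (with a trivial factor `SL_0`). -/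
abbrev SLBeta : Type u := (i : Fin (l + 1)) → SpecialLinearGroup (Fin i) k

/-- The matrix of an element of `SL_n`. -/
def SLmat {k : Type u} [Field k] {n : ℕ} (g : SpecialLinearGroup (Fin n) k) :
    Matrix (Fin n) (Fin n) k := g

theorem SLmat_mul {k : Type u} [Field k] {n : ℕ} (g h : SpecialLinearGroup (Fin n) k) :
    SLmat (g * h) = SLmat g * SLmat h := Matrix.SpecialLinearGroup.coe_mul g h

theorem SLmat_one {k : Type u} [Field k] {n : ℕ} :
    SLmat (1 : SpecialLinearGroup (Fin n) k) = 1 :=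
  Matrix.SpecialLinearGroup.coe_one

theorem det_SLmat {k : Type u} [Field k] {n : ℕ} (g : SpecialLinearGroup (Fin n) k) :
    (SLmat g).det = 1 := g.2

/-- `G = SL_l`. -/
abbrev G : Type u := SpecialLinearGroup (Fin l) k

variable {k l}

/-- The component of an element of `SL_1 × ⋯ × SL_l` at the vertex `i`. -/
def SLBeta.at (s : SLBeta k l) (i : ℕ) (hi : i ≤ l) : SpecialLinearGroup (Fin i) k :=
  s ⟨i, Nat.lt_succ_of_le hi⟩

variable (k l) in
/-- The group `SL_1 × ⋯ × SL_{l-1}`, as a subgroup of `SL_1 × ⋯ × SL_l`. -/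
abbrev SLGamma : Type u := {s : SLBeta k l // s.at l le_rfl = 1}

/-- Base change, as a right action: `A i ↦ (s i)⁻¹ * A i * s (i + 1)`. -/
def Flag.act (A : Flag k l) (s : SLBeta k l) : Flag k l := fun i =>
  SLmat (s.at i i.2.le)⁻¹ * A i * SLmat (s.at (i + 1) i.2)

/-- Base change, as a left action: `A i ↦ s (i + 1) * A i * (s i)⁻¹`. -/
def DualFlag.act (s : SLBeta k l) (A : DualFlag k l) : DualFlag k l := fun i =>
  SLmat (s.at (i + 1) i.2) * A i * SLmat (s.at i i.2.le)⁻¹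

/-- The element of `SL_1 × ⋯ × SL_l` with last component `g` and all others trivial. -/
def atLast (g : G k l) : SLBeta k l := Pi.mulSingle (Fin.last l) g

/-- The right action `A · g` of `G` on flags. -/
def Flag.mulG (A : Flag k l) (g : G k l) : Flag k l := A.act (atLast g)

/-- The left action `g · Ǎ` of `G` on dual flags. -/
def DualFlag.gMul (g : G k l) (A : DualFlag k l) : DualFlag k l := A.act (atLast g)

/-- The matrix `A(p_i)` of the path from `i` to `l`. -/
def Flag.path (A : Flag k l) (i : ℕ) (hi : i ≤ l) : Matrix (Fin i) (Fin l) k :=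
  Nat.decreasingInduction (motive := fun i _ => Matrix (Fin i) (Fin l) k)
    (fun i h M => A ⟨i, h⟩ * M) 1 hi

/-- The matrix `Ǎ(p̌_i)` of the path from `l` to `i`. -/
def DualFlag.path (A : DualFlag k l) (i : ℕ) (hi : i ≤ l) : Matrix (Fin l) (Fin i) k :=
  Nat.decreasingInduction (motive := fun i _ => Matrix (Fin l) (Fin i) k)
    (fun i h M => M * A ⟨i, h⟩) 1 hi

theorem SLBeta.at_mul (s t : SLBeta k l) (i : ℕ) (hi : i ≤ l) :
    (s * t).at i hi = s.at i hi * t.at i hi := rfl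

theorem Flag.act_mul (A : Flag k l) (s t : SLBeta k l) :
    A.act (s * t) = Flag.act (A.act s) t := by
  funext i
  simp only [Flag.act, SLBeta.at_mul, _root_.mul_inv_rev, SLmat_mul,
    Matrix.mul_assoc]

theorem DualFlag.act_mul (A : DualFlag k l) (s t : SLBeta k l) :
    DualFlag.act (s * t) A = DualFlag.act s (DualFlag.act t A) := by
  funext i
  simp only [DualFlag.act, SLBeta.at_mul, _root_.mul_inv_rev, SLmat_mul,
    Matrix.mul_assoc]

theorem atLast_mul (g h : G k l) : atLast (g * h) = atLast g * atLast h :=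
  Pi.mulSingle_mul _ _ _

theorem Flag.mulG_mul (A : Flag k l) (g h : G k l) :
    Flag.mulG A (g * h) = Flag.mulG (Flag.mulG A g) h := by
  simp only [Flag.mulG, atLast_mul, Flag.act_mul]

theorem DualFlag.gMul_mul (A : DualFlag k l) (g h : G k l) :
    DualFlag.gMul (g * h) A = DualFlag.gMul g (DualFlag.gMul h A) := by
  simp only [DualFlag.gMul, atLast_mul, DualFlag.act_mul]

theorem atLast_at_self (g : G k l) : (atLast g).at l le_rfl = g :=
  Pi.mulSingle_eq_same (M := fun i : Fin (l + 1) => SpecialLinearGroup (Fin i) k) (Fin.last l) g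

theorem atLast_at_lt (g : G k l) (i : ℕ) (hi : i < l) : (atLast g).at i hi.le = 1 :=
  Pi.mulSingle_eq_of_ne (M := fun i : Fin (l + 1) => SpecialLinearGroup (Fin i) k)
    (i := Fin.last l) (i' := ⟨i, Nat.lt_succ_of_lt hi⟩) (fun h => hi.ne (congrArg Fin.val h)) g

theorem SLBeta.ext {s t : SLBeta k l} (h : ∀ i hi, s.at i hi = t.at i hi) : s = t :=
  funext fun i => h i.1 (Nat.le_of_lt_succ i.2)

theorem atLast_comm (s : SLGamma k l) (g : G k l) : atLast g * s.1 = s.1 * atLast g := by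
  refine SLBeta.ext fun i hi => ?_
  rw [SLBeta.at_mul, SLBeta.at_mul]
  rcases hi.lt_or_eq with h | rfl
  · rw [atLast_at_lt g i h, one_mul, mul_one]
  · rw [s.2, one_mul, mul_one]

theorem Flag.act_mulG (A : Flag k l) (s : SLGamma k l) (g : G k l) :
    Flag.mulG (Flag.act A s.1) g = Flag.act (Flag.mulG A g) s.1 := by
  rw [Flag.mulG, Flag.mulG, ← Flag.act_mul, ← Flag.act_mul, atLast_comm]

theorem DualFlag.gMul_act (A : DualFlag k l) (s : SLGamma k l) (g : G k l) :
    DualFlag.gMul g (DualFlag.act s.1 A) = DualFlag.act s.1 (DualFlag.gMul g A) := by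
  rw [DualFlag.gMul, DualFlag.gMul, ← DualFlag.act_mul, ← DualFlag.act_mul, atLast_comm]

theorem Flag.path_self (A : Flag k l) : Flag.path A l le_rfl = 1 :=
  Nat.decreasingInduction_self _ _

theorem Flag.path_eq (A : Flag k l) (i : ℕ) (hi : i < l) :
    Flag.path A i hi.le = A ⟨i, hi⟩ * Flag.path A (i + 1) hi :=
  Nat.decreasingInduction_succ_left (motive := fun i _ => Matrix (Fin i) (Fin l) k) _ _ hi _

theorem DualFlag.path_self (A : DualFlag k l) : DualFlag.path A l le_rfl = 1 :=
  Nat.decreasingInduction_self _ _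

theorem DualFlag.path_eq (A : DualFlag k l) (i : ℕ) (hi : i < l) :
    DualFlag.path A i hi.le = DualFlag.path A (i + 1) hi * A ⟨i, hi⟩ :=
  Nat.decreasingInduction_succ_left (motive := fun i _ => Matrix (Fin l) (Fin i) k) _ _ hi _

theorem SL_mul_inv {n : ℕ} (g : SpecialLinearGroup (Fin n) k) : SLmat g * SLmat (g⁻¹) = 1 := by
  rw [← SLmat_mul, mul_inv_cancel, SLmat_one]

theorem SL_inv_mul {n : ℕ} (g : SpecialLinearGroup (Fin n) k) : SLmat (g⁻¹) * SLmat g = 1 := by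
  rw [← SLmat_mul, inv_mul_cancel, SLmat_one]

theorem Flag.path_act (A : Flag k l) (s : SLBeta k l) (i : ℕ) (hi : i ≤ l) :
    Flag.path (Flag.act A s) i hi =
      SLmat (s.at i hi)⁻¹ * Flag.path A i hi * SLmat (s.at l le_rfl) := by
  refine Nat.decreasingInduction (motive := fun i hi => Flag.path (Flag.act A s) i hi =
      SLmat (s.at i hi)⁻¹ * Flag.path A i hi * SLmat (s.at l le_rfl)) ?_ ?_ hi
  · intro i h ih
    rw [Flag.path_eq _ i h, Flag.path_eq _ i h, ih, Flag.act]
    simp only [Matrix.mul_assoc]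
    rw [← Matrix.mul_assoc _ _ (Flag.path A (i + 1) h * _), SL_mul_inv, Matrix.one_mul]
  · rw [Flag.path_self, Flag.path_self, Matrix.mul_one, SL_inv_mul]

theorem cancel_mid {i : ℕ} (L : Matrix (Fin l) (Fin l) k) (M : Matrix (Fin l) (Fin (i + 1)) k)
    (g : SpecialLinearGroup (Fin (i + 1)) k) (B : Matrix (Fin (i + 1)) (Fin i) k)
    (t : Matrix (Fin i) (Fin i) k) :
    (L * M * SLmat g⁻¹) * (SLmat g * B * t) = L * (M * B) * t := by
  simp only [Matrix.mul_assoc]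
  rw [← Matrix.mul_assoc (SLmat g⁻¹), SL_inv_mul, Matrix.one_mul]

theorem DualFlag.path_act (A : DualFlag k l) (s : SLBeta k l) (i : ℕ) (hi : i ≤ l) :
    DualFlag.path (DualFlag.act s A) i hi =
      SLmat (s.at l le_rfl) * DualFlag.path A i hi * SLmat (s.at i hi)⁻¹ := by
  refine Nat.decreasingInduction (motive := fun i hi => DualFlag.path (DualFlag.act s A) i hi =
      SLmat (s.at l le_rfl) * DualFlag.path A i hi * SLmat (s.at i hi)⁻¹) ?_ ?_ hi
  · intro i h ih
    rw [DualFlag.path_eq _ i h, DualFlag.path_eq _ i h, ih]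
    exact cancel_mid _ _ _ _ _
  · rw [DualFlag.path_self, DualFlag.path_self, Matrix.mul_one, SL_mul_inv]

/-! ### The varieties of flags and dual flags -/

variable (k l)

/-- The affine space of representations of the linear quiver. -/
def flagVar : AffVar k (Flag k l) :=
  coordVar fun (c : Σ i : Fin l, Fin i × Fin (i + 1)) A => A c.1 c.2.1 c.2.2

/-- The affine space of representations of the opposite quiver. -/
def dualFlagVar : AffVar k (DualFlag k l) :=
  coordVar fun (c : Σ i : Fin l, Fin (i + 1) × Fin i) A => A c.1 c.2.1 c.2.2

/-- The affine variety `G = SL_l`. -/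
def groupVar : AffVar k (G k l) :=
  coordVar fun (c : Fin l × Fin l) g => SLmat g c.1 c.2

/-- `𝒜`: flags modulo `SL_1 × ⋯ × SL_{l-1}`. -/
def flags : AffVar k (Flag k l) :=
  quotVar (flagVar k l) fun (s : SLGamma k l) A => Flag.act A s.1

/-- `𝒜̌`: dual flags modulo `SL_1 × ⋯ × SL_{l-1}`. -/
def dualFlags : AffVar k (DualFlag k l) :=
  quotVar (dualFlagVar k l) fun (s : SLGamma k l) A => DualFlag.act s.1 A

variable {k l}

theorem flag_entry_mem (i : Fin l) (a : Fin i) (b : Fin (i + 1)) :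
    (fun A : Flag k l => A i a b) ∈ flagVar k l :=
  coord_mem (fun (c : Σ i : Fin l, Fin i × Fin (i + 1)) (A : Flag k l) => A c.1 c.2.1 c.2.2)
    ⟨i, a, b⟩

theorem dualFlag_entry_mem (i : Fin l) (a : Fin (i + 1)) (b : Fin i) :
    (fun A : DualFlag k l => A i a b) ∈ dualFlagVar k l :=
  coord_mem (fun (c : Σ i : Fin l, Fin (i + 1) × Fin i) (A : DualFlag k l) => A c.1 c.2.1 c.2.2)
    ⟨i, a, b⟩

theorem entry_atLast_mem (i : ℕ) (hi : i ≤ l) (a b : Fin i) :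
    (fun g : G k l => SLmat ((atLast g).at i hi) a b) ∈ groupVar k l := by
  rcases hi.lt_or_eq with h | rfl
  · have : (fun g : G k l => SLmat ((atLast g).at i hi) a b) =
        algebraMap k (G k l → k) ((1 : Matrix (Fin i) (Fin i) k) a b) := by
      funext g; rw [atLast_at_lt g i h, SLmat_one]; rfl
    rw [this]
    exact (groupVar k l).algebraMap_mem _
  · have : (fun g : G k i => SLmat ((atLast g).at i hi) a b) = fun g => SLmat g a b := by
      funext g; rw [atLast_at_self]
    rw [this]
    exact coord_mem (fun (c : Fin i × Fin i) (g : G k i) => SLmat g c.1 c.2) (a, b)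

theorem Flag.mulG_apply (A : Flag k l) (g : G k l) (i : Fin l) :
    Flag.mulG A g i = A i * SLmat ((atLast g).at (i + 1) i.2) := by
  rw [Flag.mulG, Flag.act, atLast_at_lt g i i.2, inv_one, SLmat_one, Matrix.one_mul]

theorem DualFlag.gMul_apply (A : DualFlag k l) (g : G k l) (i : Fin l) :
    DualFlag.gMul g A i = SLmat ((atLast g).at (i + 1) i.2) * A i := by
  rw [DualFlag.gMul, DualFlag.act, atLast_at_lt g i i.2, inv_one, SLmat_one, Matrix.mul_one]

variable (k l) in
/-- The right action `𝒜 × G → 𝒜`. -/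
def actMor : Mor (prodVar (flags k l) (groupVar k l)) (flags k l) where
  map p := Flag.mulG p.1 p.2
  regular f hf := by
    refine mem_quot_prod (Mor.coordVar_regular (X := prodVar (flagVar k l) (groupVar k l))
      (φ := fun p => Flag.mulG p.1 p.2) ?_ f hf.1) ?_
    · rintro ⟨i, a, b⟩
      simp only [Flag.mulG_apply]
      exact mul_entry_mem (fun c d => fst_mem (flag_entry_mem i c d))
        (fun c d => snd_mem (entry_atLast_mem _ _ c d)) a b
    · intro s A g
      change f (Flag.mulG (Flag.act A s.1) g) = f (Flag.mulG A g)
      rw [Flag.act_mulG]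
      exact hf.2 s _

variable (k l) in
/-- The left action `G × 𝒜̌ → 𝒜̌`. -/
def dualActMor : Mor (prodVar (groupVar k l) (dualFlags k l)) (dualFlags k l) where
  map p := DualFlag.gMul p.1 p.2
  regular f hf := by
    refine mem_prod_quot (Mor.coordVar_regular (X := prodVar (groupVar k l) (dualFlagVar k l))
      (φ := fun p => DualFlag.gMul p.1 p.2) ?_ f hf.1) ?_
    · rintro ⟨i, a, b⟩
      simp only [DualFlag.gMul_apply]
      exact mul_entry_mem (fun c d => fst_mem (entry_atLast_mem _ _ c d))
        (fun c d => snd_mem (dualFlag_entry_mem i c d)) a b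
    · intro s g A
      change f (DualFlag.gMul g (DualFlag.act s.1 A)) = f (DualFlag.gMul g A)
      rw [DualFlag.gMul_act]
      exact hf.2 s _

variable (k l) in
/-- Multiplication of `G`. -/
def mulMor : Mor (prodVar (groupVar k l) (groupVar k l)) (groupVar k l) where
  map p := p.1 * p.2
  regular := by
    refine Mor.coordVar_regular ?_
    rintro ⟨a, b⟩
    simp only [SLmat_mul]
    exact mul_entry_mem (fun c d => fst_mem (coord_mem _ (c, d)))
      (fun c d => snd_mem (coord_mem _ (c, d))) a b

variable (k l) in
/-- Inversion of `G`. -/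
def invMor : Mor (groupVar k l) (groupVar k l) where
  map g := g⁻¹
  regular := by
    refine Mor.coordVar_regular ?_
    rintro ⟨a, b⟩
    have : (fun g : G k l => SLmat g⁻¹ a b) =
        fun g => ((SLmat g).updateRow b (Pi.single a 1)).det := by
      funext g
      rw [← Matrix.adjugate_apply]
      exact congrFun (congrFun (Matrix.SpecialLinearGroup.coe_inv g) a) b
    rw [this]
    refine det_mem fun i j => ?_
    by_cases h : i = b
    · subst h
      simp only [Matrix.updateRow_self]
      exact (groupVar k l).algebraMap_mem _
    · simp only [Matrix.updateRow_ne h]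
      exact coord_mem (fun (c : Fin l × Fin l) (g : G k l) => SLmat g c.1 c.2) (i, j)

/-- The constant morphism with value `1 ∈ G`. -/
def oneMor {P : Type u} (X : AffVar k P) : Mor X (groupVar k l) where
  map _ := 1
  regular f _ := X.algebraMap_mem (f 1)

/-! ### Generic pairs -/

variable (l) in
/-- The pairs `(i, j)` of vertices with `i + j = l`. -/
def splits : Finset (ℕ × ℕ) :=
  (Finset.HasAntidiagonal.antidiagonal l).filter fun p => 0 < p.1 ∧ 0 < p.2

theorem splits_add (p : splits l) : p.1.1 + p.1.2 = l :=
  Finset.HasAntidiagonal.mem_antidiagonal.1 (Finset.mem_filter.1 p.2).1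

theorem splits_fst_lt (p : splits l) : p.1.1 < l := by
  have h := splits_add p
  have h2 := (Finset.mem_filter.1 p.2).2.2
  omega

theorem splits_snd_lt (p : splits l) : p.1.2 < l := by
  have h := splits_add p
  have h2 := (Finset.mem_filter.1 p.2).2.1
  omega

/-- The bijection of row (or column) indices underlying `l = i + j`. -/
def splitEquiv (p : splits l) : Fin l ≃ Fin p.1.1 ⊕ Fin p.1.2 :=
  (finCongr (splits_add p).symm).trans finSumFinEquiv.symm

/-- The square matrix with the rows of `A₁(p_i)` above those of `A₂(p_j)`, where `i + j = l`. -/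
def stack (p : splits l) (A₁ A₂ : Flag k l) : Matrix (Fin l) (Fin l) k :=
  (Matrix.fromRows (Flag.path A₁ p.1.1 (splits_fst_lt p).le)
    (Flag.path A₂ p.1.2 (splits_snd_lt p).le)).submatrix (splitEquiv p) id

/-- The square matrix with the columns of `Ǎ₁(p̌_i)` before those of `Ǎ₂(p̌_j)`, where
`i + j = l`. -/
def dualStack (p : splits l) (A₁ A₂ : DualFlag k l) : Matrix (Fin l) (Fin l) k :=
  (Matrix.fromCols (DualFlag.path A₁ p.1.1 (splits_fst_lt p).le)
    (DualFlag.path A₂ p.1.2 (splits_snd_lt p).le)).submatrix id (splitEquiv p)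

/-- The square matrix `A(p_i) Ǎ(p̌_i)`. -/
def pairing (i : Fin l) (A : Flag k l) (B : DualFlag k l) : Matrix (Fin i) (Fin i) k :=
  Flag.path A i i.2.le * DualFlag.path B i i.2.le

theorem Flag.path_entry_mem (i : ℕ) (hi : i ≤ l) :
    ∀ (a : Fin i) (b : Fin l), (fun A : Flag k l => Flag.path A i hi a b) ∈ flagVar k l := by
  refine Nat.decreasingInduction (motive := fun i hi => ∀ (a : Fin i) (b : Fin l),
    (fun A : Flag k l => Flag.path A i hi a b) ∈ flagVar k l) ?_ ?_ hi
  · intro i h ih a b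
    simp only [Flag.path_eq _ i h]
    exact mul_entry_mem (fun c d => flag_entry_mem ⟨i, h⟩ c d) ih a b
  · intro a b
    simp only [Flag.path_self]
    exact (flagVar k l).algebraMap_mem _

theorem DualFlag.path_entry_mem (i : ℕ) (hi : i ≤ l) : ∀ (a : Fin l) (b : Fin i),
    (fun A : DualFlag k l => DualFlag.path A i hi a b) ∈ dualFlagVar k l := by
  refine Nat.decreasingInduction (motive := fun i hi => ∀ (a : Fin l) (b : Fin i),
    (fun A : DualFlag k l => DualFlag.path A i hi a b) ∈ dualFlagVar k l) ?_ ?_ hi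
  · intro i h ih a b
    simp only [DualFlag.path_eq _ i h]
    exact mul_entry_mem ih (fun c d => dualFlag_entry_mem ⟨i, h⟩ c d) a b
  · intro a b
    simp only [DualFlag.path_self]
    exact (dualFlagVar k l).algebraMap_mem _

theorem Flag.path_mulG (A : Flag k l) (g : G k l) (i : ℕ) (hi : i < l) :
    Flag.path (Flag.mulG A g) i hi.le = Flag.path A i hi.le * SLmat g := by
  rw [Flag.mulG, Flag.path_act, atLast_at_self, atLast_at_lt g i hi, inv_one, SLmat_one,
    Matrix.one_mul]

theorem DualFlag.path_gMul (A : DualFlag k l) (g : G k l) (i : ℕ) (hi : i < l) :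
    DualFlag.path (DualFlag.gMul g A) i hi.le = SLmat g * DualFlag.path A i hi.le := by
  rw [DualFlag.gMul, DualFlag.path_act, atLast_at_self, atLast_at_lt g i hi, inv_one, SLmat_one,
    Matrix.mul_one]

theorem Flag.path_act_gamma (A : Flag k l) (s : SLGamma k l) (i : ℕ) (hi : i ≤ l) :
    Flag.path (Flag.act A s.1) i hi = SLmat (s.1.at i hi)⁻¹ * Flag.path A i hi := by
  rw [Flag.path_act, s.2, SLmat_one, Matrix.mul_one]

theorem DualFlag.path_act_gamma (A : DualFlag k l) (s : SLGamma k l) (i : ℕ) (hi : i ≤ l) :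
    DualFlag.path (DualFlag.act s.1 A) i hi =
      DualFlag.path A i hi * SLmat (s.1.at i hi)⁻¹ := by
  rw [DualFlag.path_act, s.2, SLmat_one, Matrix.one_mul]

theorem det_blockRows {a b n : Type} [Fintype a] [Fintype b] [Fintype n] [DecidableEq a]
    [DecidableEq b] [DecidableEq n] (e : n ≃ a ⊕ b) (M : Matrix a a k) (N : Matrix b b k)
    (A : Matrix a n k) (B : Matrix b n k) :
    ((Matrix.fromRows (M * A) (N * B)).submatrix e id).det =
      M.det * N.det * ((Matrix.fromRows A B).submatrix e id).det := by
  have h : Matrix.fromRows (M * A) (N * B) =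
      Matrix.fromBlocks M 0 0 N * Matrix.fromRows A B := by
    simp [Matrix.fromBlocks_mul_fromRows]
  rw [h, ← Matrix.submatrix_mul_equiv _ _ e e id, Matrix.det_mul,
    Matrix.det_submatrix_equiv_self, Matrix.det_fromBlocks_zero₂₁]

theorem det_blockCols {a b n : Type} [Fintype a] [Fintype b] [Fintype n] [DecidableEq a]
    [DecidableEq b] [DecidableEq n] (e : n ≃ a ⊕ b) (M : Matrix a a k) (N : Matrix b b k)
    (A : Matrix n a k) (B : Matrix n b k) :
    ((Matrix.fromCols (A * M) (B * N)).submatrix id e).det =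
      M.det * N.det * ((Matrix.fromCols A B).submatrix id e).det := by
  have h := det_blockRows e Mᵀ Nᵀ Aᵀ Bᵀ
  rw [← Matrix.transpose_mul, ← Matrix.transpose_mul, ← Matrix.transpose_fromCols,
    ← Matrix.transpose_fromCols, ← Matrix.transpose_submatrix, ← Matrix.transpose_submatrix,
    Matrix.det_transpose, Matrix.det_transpose, Matrix.det_transpose, Matrix.det_transpose] at h
  exact h

theorem stack_mulG (p : splits l) (A₁ A₂ : Flag k l) (g : G k l) :
    stack p (Flag.mulG A₁ g) (Flag.mulG A₂ g) = stack p A₁ A₂ * SLmat g := by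
  rw [stack, stack, Flag.path_mulG _ _ _ (splits_fst_lt p),
    Flag.path_mulG _ _ _ (splits_snd_lt p), ← Matrix.fromRows_mul]
  rfl

theorem dualStack_gMul (p : splits l) (A₁ A₂ : DualFlag k l) (g : G k l) :
    dualStack p (DualFlag.gMul g A₁) (DualFlag.gMul g A₂) = SLmat g * dualStack p A₁ A₂ := by
  rw [dualStack, dualStack, DualFlag.path_gMul _ _ _ (splits_fst_lt p),
    DualFlag.path_gMul _ _ _ (splits_snd_lt p), ← Matrix.mul_fromCols]
  rfl

theorem pairing_act (i : Fin l) (A : Flag k l) (B : DualFlag k l) (g : G k l) :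
    pairing i (Flag.mulG A g⁻¹) (DualFlag.gMul g B) = pairing i A B := by
  rw [pairing, pairing, Flag.path_mulG _ _ _ i.2, DualFlag.path_gMul _ _ _ i.2,
    Matrix.mul_assoc, ← Matrix.mul_assoc (SLmat g⁻¹), SL_inv_mul, Matrix.one_mul]

variable (k l) in
/-- `(𝒜 × 𝒜) / G`. -/
def X20 : AffVar k (Flag k l × Flag k l) :=
  quotVar (prodVar (flags k l) (flags k l)) fun (g : G k l) p =>
    (Flag.mulG p.1 g⁻¹, Flag.mulG p.2 g⁻¹)

variable (k l) in
/-- `(𝒜 × 𝒜̌) / G`. -/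
def X11 : AffVar k (Flag k l × DualFlag k l) :=
  quotVar (prodVar (flags k l) (dualFlags k l)) fun (g : G k l) p =>
    (Flag.mulG p.1 g⁻¹, DualFlag.gMul g p.2)

variable (k l) in
/-- `(𝒜̌ × 𝒜̌) / G`. -/
def X02 : AffVar k (DualFlag k l × DualFlag k l) :=
  quotVar (prodVar (dualFlags k l) (dualFlags k l)) fun (g : G k l) p =>
    (DualFlag.gMul g p.1, DualFlag.gMul g p.2)

/-- The function `(A₁, A₂) ↦ det [A₁(p_i); A₂(p_j)]`. -/
def s20 (p : splits l) : X20 k l :=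
  ⟨fun q => (stack p q.1 q.2).det, by
    refine mem_quotVar.2 ⟨mem_quot_prod_quot (det_mem fun a b => ?_) ?_ ?_, ?_⟩
    · rcases h : splitEquiv p a with c | c
      · simp only [stack, Matrix.submatrix_apply, h, Matrix.fromRows_apply_inl]
        exact fst_mem (Flag.path_entry_mem _ _ _ _)
      · simp only [stack, Matrix.submatrix_apply, h, Matrix.fromRows_apply_inr]
        exact snd_mem (Flag.path_entry_mem _ _ _ _)
    · intro s A₁ A₂
      simpa [stack, Flag.path_act_gamma, det_SLmat] using
        det_blockRows (splitEquiv p) (SLmat (s.1.at _ (splits_fst_lt p).le)⁻¹) 1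
          (Flag.path A₁ p.1.1 (splits_fst_lt p).le) (Flag.path A₂ p.1.2 (splits_snd_lt p).le)
    · intro s A₁ A₂
      simpa [stack, Flag.path_act_gamma, det_SLmat] using
        det_blockRows (splitEquiv p) 1 (SLmat (s.1.at _ (splits_snd_lt p).le)⁻¹)
          (Flag.path A₁ p.1.1 (splits_fst_lt p).le) (Flag.path A₂ p.1.2 (splits_snd_lt p).le)
    · rintro g ⟨A₁, A₂⟩
      simp only [stack_mulG, Matrix.det_mul, det_SLmat, mul_one]⟩

/-- The function `(A, Ǎ) ↦ det (A(p_i) Ǎ(p̌_i))`. -/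
def s11 (i : Fin l) : X11 k l :=
  ⟨fun q => (pairing i q.1 q.2).det, by
    refine mem_quotVar.2 ⟨mem_quot_prod_quot (det_mem fun a b => mul_entry_mem
      (fun c d => fst_mem (Flag.path_entry_mem _ _ _ _))
      (fun c d => snd_mem (DualFlag.path_entry_mem _ _ _ _)) a b) ?_ ?_, ?_⟩
    · intro s A B
      simp only [pairing, Flag.path_act_gamma, Matrix.mul_assoc]
      rw [Matrix.det_mul, det_SLmat, one_mul]
    · intro s A B
      simp only [pairing, DualFlag.path_act_gamma, ← Matrix.mul_assoc]
      rw [Matrix.det_mul, det_SLmat, mul_one]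
    · rintro g ⟨A, B⟩
      simp only [pairing_act]⟩

/-- The function `(Ǎ₁, Ǎ₂) ↦ det [Ǎ₁(p̌_i), Ǎ₂(p̌_j)]`. -/
def s02 (p : splits l) : X02 k l :=
  ⟨fun q => (dualStack p q.1 q.2).det, by
    refine mem_quotVar.2 ⟨mem_quot_prod_quot (det_mem fun a b => ?_) ?_ ?_, ?_⟩
    · rcases h : splitEquiv p b with c | c
      · simp only [dualStack, Matrix.submatrix_apply, h, Matrix.fromCols_apply_inl]
        exact fst_mem (DualFlag.path_entry_mem _ _ _ _)
      · simp only [dualStack, Matrix.submatrix_apply, h, Matrix.fromCols_apply_inr]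
        exact snd_mem (DualFlag.path_entry_mem _ _ _ _)
    · intro s A₁ A₂
      simpa [dualStack, DualFlag.path_act_gamma, det_SLmat] using
        det_blockCols (splitEquiv p) (SLmat (s.1.at _ (splits_fst_lt p).le)⁻¹) 1
          (DualFlag.path A₁ p.1.1 (splits_fst_lt p).le)
          (DualFlag.path A₂ p.1.2 (splits_snd_lt p).le)
    · intro s A₁ A₂
      simpa [dualStack, DualFlag.path_act_gamma, det_SLmat] using
        det_blockCols (splitEquiv p) 1 (SLmat (s.1.at _ (splits_snd_lt p).le)⁻¹)
          (DualFlag.path A₁ p.1.1 (splits_fst_lt p).le)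
          (DualFlag.path A₂ p.1.2 (splits_snd_lt p).le)
    · rintro g ⟨A₁, A₂⟩
      simp only [dualStack_gMul, Matrix.det_mul, det_SLmat, one_mul]⟩

variable (k l) in
/-- The open set of generic pairs `(A₁, A₂)`: all the (square) matrices `[A₁(p_i); A₂(p_j)]` with
`i + j = l` have full rank, that is, non-zero determinant. -/
def generic20 : (spec (X20 k l)).Opens := ⨅ p : splits l, principal (X20 k l) (s20 p)

variable (k l) in
/-- The open set of generic pairs `(A, Ǎ)`: all the (square) matrices `A(p_i) Ǎ(p̌_i)` with
`i < l` have full rank, that is, non-zero determinant. (For `i = 0` the matrix is empty and imposes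
no condition.) -/
def generic11 : (spec (X11 k l)).Opens := ⨅ i : Fin l, principal (X11 k l) (s11 i)

variable (k l) in
/-- The open set of generic pairs `(Ǎ₁, Ǎ₂)`: all the (square) matrices `[Ǎ₁(p̌_i), Ǎ₂(p̌_j)]` with
`i + j = l` have full rank, that is, non-zero determinant. -/
def generic02 : (spec (X02 k l)).Opens := ⨅ p : splits l, principal (X02 k l) (s02 p)

/-! ### The variety `X_{2,2}` -/

variable (k l) in
/-- The set of quadruples `((A₁, A₂), (Ǎ₁, Ǎ₂))`. -/
abbrev Quad : Type u := (Flag k l × Flag k l) × (DualFlag k l × DualFlag k l)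

/-- The diagonal action of `G` on quadruples. -/
def Quad.act (g : G k l) (q : Quad k l) : Quad k l :=
  ((Flag.mulG q.1.1 g⁻¹, Flag.mulG q.1.2 g⁻¹), (DualFlag.gMul g q.2.1, DualFlag.gMul g q.2.2))

variable (k l) in
/-- `𝒜² × 𝒜̌²`. -/
def quads : AffVar k (Quad k l) :=
  prodVar (prodVar (flags k l) (flags k l)) (prodVar (dualFlags k l) (dualFlags k l))

variable (k l) in
/-- `X_{2,2} = (𝒜² × 𝒜̌²) / G`. -/
def X22 : AffVar k (Quad k l) := quotVar (quads k l) Quad.act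

variable (k l) in
/-- The projection to `(A₁, A₂)`. -/
def p12 : Mor (X22 k l) (X20 k l) :=
  Mor.quotMap (Mor.fst _ _) fun g _ => ⟨g, rfl⟩

variable (k l) in
/-- The projection to `(A₁, Ǎ₂)`. -/
def p14 : Mor (X22 k l) (X11 k l) :=
  Mor.quotMap (X := quads k l) (Y := prodVar (flags k l) (dualFlags k l))
    (Mor.pair ((Mor.fst _ _).comp (Mor.fst _ _)) ((Mor.snd _ _).comp (Mor.snd _ _)))
    fun g _ => ⟨g, rfl⟩

variable (k l) in
/-- The projection to `(A₂, Ǎ₁)`. -/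
def p23 : Mor (X22 k l) (X11 k l) :=
  Mor.quotMap (X := quads k l) (Y := prodVar (flags k l) (dualFlags k l))
    (Mor.pair ((Mor.snd _ _).comp (Mor.fst _ _)) ((Mor.fst _ _).comp (Mor.snd _ _)))
    fun g _ => ⟨g, rfl⟩

variable (k l) in
/-- The projection to `(Ǎ₂, Ǎ₁)`. -/
def p43 : Mor (X22 k l) (X02 k l) :=
  Mor.quotMap (X := quads k l) (Y := prodVar (dualFlags k l) (dualFlags k l))
    (Mor.pair ((Mor.snd _ _).comp (Mor.snd _ _)) ((Mor.fst _ _).comp (Mor.snd _ _)))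
    fun g _ => ⟨g, rfl⟩

variable (k l) in
/-- `X_{2,2}^∘`: the pairs `(A₁, A₂)`, `(A₁, Ǎ₂)`, `(A₂, Ǎ₁)`, `(Ǎ₂, Ǎ₁)` are generic. -/
def X22circ : (spec (X22 k l)).Opens :=
  ((p12 k l).spec ⁻¹ᵁ generic20 k l ⊓ (p14 k l).spec ⁻¹ᵁ generic11 k l) ⊓
    ((p23 k l).spec ⁻¹ᵁ generic11 k l ⊓ (p43 k l).spec ⁻¹ᵁ generic02 k l)

variable (k l) in
/-- `X_{2,2}^{ⓜ}`: the pairs `(A₁, Ǎ₂)`, `(A₂, Ǎ₁)` are generic if `m` is even, the pairs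
`(A₁, A₂)`, `(Ǎ₂, Ǎ₁)` are generic if `m` is odd. -/
def X22circled (m : ℕ) : (spec (X22 k l)).Opens :=
  if Even m then (p14 k l).spec ⁻¹ᵁ generic11 k l ⊓ (p23 k l).spec ⁻¹ᵁ generic11 k l
  else (p12 k l).spec ⁻¹ᵁ generic20 k l ⊓ (p43 k l).spec ⁻¹ᵁ generic02 k l

/-! ### The variety `Z_{l,l}^m` -/

/-- The alternating product `g_{[n]} = g_1 g_2⁻¹ g_3 ⋯ g_n^{±1}`. -/
def altProd {Γ : Type u} [Group Γ] (g : ℕ → Γ) : ℕ → Γ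
  | 0 => 1
  | n + 1 => altProd g n * (if Even n then g (n + 1) else (g (n + 1))⁻¹)

/-- The alternating product in reverse order, `g_n^{±1} ⋯ g_3 g_2⁻¹ g_1`. -/
def revProd {Γ : Type u} [Group Γ] (g : ℕ → Γ) : ℕ → Γ
  | 0 => 1
  | n + 1 => (if Even n then g (n + 1) else (g (n + 1))⁻¹) * revProd g n

variable (k l) in
/-- The set of tuples `((A, (g_1, …, g_m)), Ǎ)`. -/
abbrev Tup (m : ℕ) : Type u := (Flag k l × (Finset.Icc 1 m → G k l)) × DualFlag k l

/-- The family `g_1, …, g_m` of a tuple, continued by `1`. -/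
def Tup.g {m : ℕ} (t : Tup k l m) (n : ℕ) : G k l :=
  if h : n ∈ Finset.Icc 1 m then t.1.2 ⟨n, h⟩ else 1

/-- The action of `G × G` on tuples. -/
def Tup.act {m : ℕ} (γ : G k l × G k l) (t : Tup k l m) : Tup k l m :=
  ((Flag.mulG t.1.1 γ.1⁻¹, fun i => γ.1 * t.1.2 i * γ.2⁻¹), DualFlag.gMul γ.2 t.2)

variable (k l) in
/-- `𝒜 × G^m × 𝒜̌`. -/
def tups (m : ℕ) : AffVar k (Tup k l m) :=
  prodVar (prodVar (flags k l) (powVar (Finset.Icc 1 m) (groupVar k l))) (dualFlags k l)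

variable (k l) in
/-- `Z_{l,l}^m = (𝒜 × G^m × 𝒜̌) / (G × G)`. -/
def Z (m : ℕ) : AffVar k (Tup k l m) := quotVar (tups k l m) Tup.act

theorem Tup.act_g {m : ℕ} (γ : G k l × G k l) (t : Tup k l m) {n : ℕ} (h1 : 1 ≤ n)
    (h2 : n ≤ m) : (Tup.act γ t).g n = γ.1 * t.g n * γ.2⁻¹ := by
  have h : n ∈ Finset.Icc 1 m := Finset.mem_Icc.2 ⟨h1, h2⟩
  simp only [Tup.g, dif_pos h, Tup.act]

theorem Tup.altProd_act {m : ℕ} (γ : G k l × G k l) (t : Tup k l m) (n : ℕ) (h : n ≤ m) :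
    altProd (Tup.act γ t).g n =
      γ.1 * altProd t.g n * (if Even n then γ.1⁻¹ else γ.2⁻¹) := by
  induction n with
  | zero => simp [altProd]
  | succ n ih =>
    rw [altProd, altProd, ih (by omega), Tup.act_g γ t (by omega) h]
    by_cases hn : Even n
    · simp [hn, Nat.even_add_one, _root_.mul_assoc]
    · simp [hn, Nat.even_add_one, _root_.mul_assoc]

theorem Tup.revProd_act {m : ℕ} (γ : G k l × G k l) (t : Tup k l m) (n : ℕ) (h : n ≤ m) :
    revProd (Tup.act γ t).g n =
      (if Even n then γ.2 else γ.1) * revProd t.g n * γ.2⁻¹ := by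
  induction n with
  | zero => simp [revProd]
  | succ n ih =>
    rw [revProd, revProd, ih (by omega), Tup.act_g γ t (by omega) h]
    by_cases hn : Even n
    · simp [hn, Nat.even_add_one, _root_.mul_assoc]
    · simp [hn, Nat.even_add_one, _root_.mul_assoc]

theorem Flag.mulG_act (A : Flag k l) (a w b : G k l) :
    Flag.mulG (Flag.mulG A a⁻¹) (a * w * b) = Flag.mulG (Flag.mulG A w) b := by
  rw [← Flag.mulG_mul, ← Flag.mulG_mul, _root_.mul_assoc, inv_mul_cancel_left]

theorem DualFlag.act_gMul (A : DualFlag k l) (a w b : G k l) :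
    DualFlag.gMul (b * w * a⁻¹) (DualFlag.gMul a A) = DualFlag.gMul b (DualFlag.gMul w A) := by
  rw [← DualFlag.gMul_mul, ← DualFlag.gMul_mul, inv_mul_cancel_right]

/-- The coordinate `g_n` of a tuple as a morphism to `G`. -/
def gMor (m n : ℕ) : Mor (tups k l m) (groupVar k l) where
  map t := t.g n
  regular := by
    by_cases h : n ∈ Finset.Icc 1 m
    · simp only [Tup.g, dif_pos h]
      exact (((Mor.proj (Finset.Icc 1 m) (groupVar k l) ⟨n, h⟩).comp (Mor.snd _ _)).comp
        (Mor.fst _ _)).regular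
    · simp only [Tup.g, dif_neg h]
      exact (oneMor (tups k l m)).regular

theorem sign_regular (m n : ℕ) : ∀ f ∈ groupVar k l, (fun t : Tup k l m =>
    f (if Even n then t.g (n + 1) else (t.g (n + 1))⁻¹)) ∈ tups k l m := by
  by_cases hn : Even n
  · simp only [if_pos hn]
    exact (gMor m (n + 1)).regular
  · simp only [if_neg hn]
    exact ((invMor k l).comp (gMor m (n + 1))).regular

/-- `g_{[n]}` as a morphism to `G`. -/
def altMor (m n : ℕ) : Mor (tups k l m) (groupVar k l) where
  map t := altProd t.g n
  regular := by
    induction n with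
    | zero => exact (oneMor (tups k l m)).regular
    | succ n ih => exact ((mulMor k l).comp (Mor.pair ⟨_, ih⟩ ⟨_, sign_regular m n⟩)).regular

/-- The reverse alternating product as a morphism to `G`. -/
def revMor (m n : ℕ) : Mor (tups k l m) (groupVar k l) where
  map t := revProd t.g n
  regular := by
    induction n with
    | zero => exact (oneMor (tups k l m)).regular
    | succ n ih => exact ((mulMor k l).comp (Mor.pair ⟨_, sign_regular m n⟩ ⟨_, ih⟩)).regular

/-- The component `A` of a tuple. -/
def flagMor (m : ℕ) : Mor (tups k l m) (flags k l) := (Mor.fst _ _).comp (Mor.fst _ _)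

/-- The component `Ǎ` of a tuple. -/
def dualFlagMor (m : ℕ) : Mor (tups k l m) (dualFlags k l) := Mor.snd _ _

/-- `(A, g_1, …, g_m, Ǎ) ↦ A · w`, for `w` a morphism to `G`. -/
def flagTimes {m : ℕ} (w : Mor (tups k l m) (groupVar k l)) : Mor (tups k l m) (flags k l) :=
  (actMor k l).comp (Mor.pair (flagMor m) w)

/-- `(A, g_1, …, g_m, Ǎ) ↦ w · Ǎ`, for `w` a morphism to `G`. -/
def timesDual {m : ℕ} (w : Mor (tups k l m) (groupVar k l)) :
    Mor (tups k l m) (dualFlags k l) :=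
  (dualActMor k l).comp (Mor.pair w (dualFlagMor m))

/-- The map `(A, g, Ǎ) ↦ (A g_{[n-1]}, A g_n, g_n⁻¹ ⋯ g_1 Ǎ, Ǎ)`, used for even `n`. -/
def piEven (m n : ℕ) : Mor (tups k l m) (quads k l) :=
  Mor.pair (Mor.pair (flagTimes (altMor m (n - 1))) (flagTimes (gMor m n)))
    (Mor.pair (timesDual (revMor m n)) (dualFlagMor m))

/-- The map `(A, g, Ǎ) ↦ (A g_{[n-1]}, A, g_n ⋯ g_1 Ǎ, g_n Ǎ)`, used for odd `n`. -/
def piOdd (m n : ℕ) : Mor (tups k l m) (quads k l) :=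
  Mor.pair (Mor.pair (flagTimes (altMor m (n - 1))) (flagMor m))
    (Mor.pair (timesDual (revMor m n)) (timesDual (gMor m n)))

/-- The map `𝒜 × G^m × 𝒜̌ → 𝒜² × 𝒜̌²` underlying `π_n`. -/
def piTilde (m n : ℕ) : Mor (tups k l m) (quads k l) :=
  if Even n then piEven m n else piOdd m n

theorem piTilde_act {m n : ℕ} (h : n ∈ Finset.Icc 2 m) (γ : G k l × G k l) (t : Tup k l m) :
    ∃ g, (piTilde m n).map (Tup.act γ t) = Quad.act g ((piTilde m n).map t) := by
  obtain ⟨h2, hm⟩ := Finset.mem_Icc.1 h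
  have ha := Tup.altProd_act γ t (n - 1) (by omega)
  have hr := Tup.revProd_act γ t n hm
  have hg := Tup.act_g γ t (n := n) (by omega) hm
  by_cases hn : Even n
  · have hn' : ¬ Even (n - 1) := by
      rw [Nat.even_sub (by omega)]; simp [hn]
    rw [if_neg hn'] at ha
    rw [if_pos hn] at hr
    refine ⟨γ.2, ?_⟩
    rw [show piTilde (k := k) (l := l) m n = piEven m n from if_pos hn]
    change ((Flag.mulG (Flag.mulG t.1.1 γ.1⁻¹) (altProd (Tup.act γ t).g (n - 1)),
      Flag.mulG (Flag.mulG t.1.1 γ.1⁻¹) ((Tup.act γ t).g n)),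
      (DualFlag.gMul (revProd (Tup.act γ t).g n) (DualFlag.gMul γ.2 t.2),
        DualFlag.gMul γ.2 t.2)) = _
    rw [ha, hr, hg, Flag.mulG_act, Flag.mulG_act, DualFlag.act_gMul]
    rfl
  · have hn' : Even (n - 1) := by
      rw [Nat.even_sub (by omega)]; simp [hn]
    rw [if_pos hn'] at ha
    rw [if_neg hn] at hr
    refine ⟨γ.1, ?_⟩
    rw [show piTilde (k := k) (l := l) m n = piOdd m n from if_neg hn]
    change ((Flag.mulG (Flag.mulG t.1.1 γ.1⁻¹) (altProd (Tup.act γ t).g (n - 1)),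
      Flag.mulG t.1.1 γ.1⁻¹),
      (DualFlag.gMul (revProd (Tup.act γ t).g n) (DualFlag.gMul γ.2 t.2),
        DualFlag.gMul ((Tup.act γ t).g n) (DualFlag.gMul γ.2 t.2))) = _
    rw [ha, hr, hg, Flag.mulG_act, DualFlag.act_gMul, DualFlag.act_gMul]
    rfl

variable (k l) in
/-- The map `π_n : Z_{l,l}^m → X_{2,2}`, for `2 ≤ n ≤ m`. -/
def piMor (m : ℕ) (n : Finset.Icc 2 m) : Mor (Z k l m) (X22 k l) :=
  Mor.quotMap (piTilde m n) (piTilde_act n.2)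

variable (k l) in
/-- The variety `(X_{2,2})^{m-1}`, its factors being indexed by `2, …, m`. -/
def target (m : ℕ) : AffVar k (Finset.Icc 2 m → Quad k l) := powVar (Finset.Icc 2 m) (X22 k l)

variable (k l) in
/-- The map `π = (π_2, …, π_m) : Z_{l,l}^m → (X_{2,2})^{m-1}`. -/
def piMap (m : ℕ) : Mor (Z k l m) (target k l m) := Mor.lift (piMor k l m)

variable (k l) in
/-- The open set `(X_{2,2}^∘)^{m-2} × X_{2,2}^{ⓜ}` of `(X_{2,2})^{m-1}`. -/
def targetOpen (m : ℕ) : (spec (target k l m)).Opens :=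
  ⨅ n : Finset.Icc 2 m, (Mor.proj (Finset.Icc 2 m) (X22 k l) n).spec ⁻¹ᵁ
    (if n.1 = m then X22circled k l m else X22circ k l)

/-! ### The open set `(Z_{l,l}^m)^∘_π` -/

section

variable {m n : ℕ}

/-- The class of the pair `(A g_{[n]}, A)`, for even `n ≤ m`. -/
def altFlagPair (h : n ≤ m) (hn : Even n) : Mor (Z k l m) (X20 k l) :=
  Mor.quotMap (X := tups k l m) (Y := prodVar (flags k l) (flags k l))
    (Mor.pair (flagTimes (altMor m n)) (flagMor m)) (by
      intro γ t
      refine ⟨γ.1, ?_⟩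
      change (Flag.mulG (Flag.mulG t.1.1 γ.1⁻¹) (altProd (Tup.act γ t).g n),
        Flag.mulG t.1.1 γ.1⁻¹) = _
      rw [Tup.altProd_act γ t n h, if_pos hn, Flag.mulG_act]
      rfl)

/-- The class of the pair `(Ǎ, g_n^{±1} ⋯ g_1 Ǎ)`, for even `n ≤ m`. -/
def revDualPair (h : n ≤ m) (hn : Even n) : Mor (Z k l m) (X02 k l) :=
  Mor.quotMap (X := tups k l m) (Y := prodVar (dualFlags k l) (dualFlags k l))
    (Mor.pair (dualFlagMor m) (timesDual (revMor m n))) (by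
      intro γ t
      refine ⟨γ.2, ?_⟩
      change (DualFlag.gMul γ.2 t.2,
        DualFlag.gMul (revProd (Tup.act γ t).g n) (DualFlag.gMul γ.2 t.2)) = _
      rw [Tup.revProd_act γ t n h, if_pos hn, DualFlag.act_gMul]
      rfl)

/-- The class of the pair `(A g_{[n]}, Ǎ)`, for odd `n ≤ m`. -/
def altMixedPair (h : n ≤ m) (hn : ¬ Even n) : Mor (Z k l m) (X11 k l) :=
  Mor.quotMap (X := tups k l m) (Y := prodVar (flags k l) (dualFlags k l))
    (Mor.pair (flagTimes (altMor m n)) (dualFlagMor m)) (by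
      intro γ t
      refine ⟨γ.2, ?_⟩
      change (Flag.mulG (Flag.mulG t.1.1 γ.1⁻¹) (altProd (Tup.act γ t).g n),
        DualFlag.gMul γ.2 t.2) = _
      rw [Tup.altProd_act γ t n h, if_neg hn, Flag.mulG_act]
      rfl)

/-- The class of the pair `(A, g_n^{±1} ⋯ g_1 Ǎ)`, for odd `n ≤ m`. -/
def revMixedPair (h : n ≤ m) (hn : ¬ Even n) : Mor (Z k l m) (X11 k l) :=
  Mor.quotMap (X := tups k l m) (Y := prodVar (flags k l) (dualFlags k l))
    (Mor.pair (flagMor m) (timesDual (revMor m n))) (by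
      intro γ t
      refine ⟨γ.1, ?_⟩
      change (Flag.mulG t.1.1 γ.1⁻¹,
        DualFlag.gMul (revProd (Tup.act γ t).g n) (DualFlag.gMul γ.2 t.2)) = _
      rw [Tup.revProd_act γ t n h, if_neg hn, DualFlag.act_gMul]
      rfl)

end

theorem le_of_mem_Icc_pred {m : ℕ} (n : Finset.Icc 1 (m - 1)) : n.1 ≤ m :=
  (Finset.mem_Icc.1 n.2).2.trans (Nat.sub_le _ _)

variable (k l) in
/-- `(Z_{l,l}^m)^∘_π`: for all `n ∈ [1, m - 1]`, the pairs `(A g_{[n]}, A)` and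
`(Ǎ, g_n⁻¹ ⋯ g_1 Ǎ)` are generic if `n` is even, and the pairs `(A g_{[n]}, Ǎ)` and
`(A, g_n ⋯ g_1 Ǎ)` are generic if `n` is odd. -/
def Zopen (m : ℕ) : (spec (Z k l m)).Opens :=
  ⨅ n : Finset.Icc 1 (m - 1),
    if hn : Even n.1 then
      (altFlagPair (le_of_mem_Icc_pred n) hn).spec ⁻¹ᵁ generic20 k l ⊓
        (revDualPair (le_of_mem_Icc_pred n) hn).spec ⁻¹ᵁ generic02 k l
    else
      (altMixedPair (le_of_mem_Icc_pred n) hn).spec ⁻¹ᵁ generic11 k l ⊓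
        (revMixedPair (le_of_mem_Icc_pred n) hn).spec ⁻¹ᵁ generic11 k l

end Flags

end FlaggedKronecker

end

/-! The target open set is a principal open set `h ≠ 0`, and its full preimage under `π` is exactly
`(Z_{l,l}^m)^∘_π` (`piMap_preimage_targetOpen`). This gives the inclusion of open sets, and reduces
the closed embedding to a surjectivity statement: every invariant function `F` on `Z`, times a power
of `π^*h`, is a pullback. Equivalently, `F` restricted to the points with `π^*h ≠ 0` lies in the
algebra `locAlg h` of quotients `π^*q / π^*h^N`.

The main tool is a frame attached to each kind of pair: a square matrix built polynomially from the
pair, invariant under base change at the vertices below `l`, and multiplied on the left by `g` under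
`g ∈ G`. The determinant of the frame is a product, or a power of a product, of the determinants
that define genericity (`det_mixedFrame`, `det_flagFrame`), so it is a unit on the generic locus. If
`M` and `N` are two frames on quadruples, `adj(M) N` is an invariant, so `M⁻¹N` is regular wherever
`M` is generic (`IsFrame.transfer`).

On `Z` this yields left frames `L_n` and right frames `R_n`, with `L_1 = g_1 R_1`. The factor
`π_{j+1}` supplies `L_j⁻¹ g_{j+1} R_j`, and for `j + 1 < m` the stronger genericity also supplies
`L_j⁻¹ L_{j+1}` and `R_{j+1}⁻¹ R_j`. Composing along the chain, `L_1⁻¹ g_n R_1` has entries in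
`locAlg h` for every `n` (`transfer_group`).

Finally `L_1`, rescaled to determinant one, is used to move a tuple to a normal form in its `G × G ×
SL_γ × SL_γ` orbit (`Z_eq_normalForm`). The flag and dual flag become standard, with parameters that
are units of `locAlg h`, and the group elements become conjugates of `L_1⁻¹ g_n R_1` by diagonal
matrices. Thus all coordinates of the normal form lie in `locAlg h`, and so does the value of `F`
there, which is the value of `F` at the original tuple (`restrict_mem_locAlg`). -/

noncomputable section

namespace FlaggedKronecker

/-! ### Closed immersions over principal open sets, and localized pullbacks -/

section LocalizedPullback

variable {k P Q : Type u} [Field k] {X : AffVar k P} {Y : AffVar k Q}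

/-- Over a principal open set the restricted morphism is `Spec` of the map of localizations away
from `h`; that map is surjective exactly when each `F` becomes a pullback after multiplication by a
power of `h`. -/
theorem isClosedImmersion_of_pullback_surjective (φ : Mor X Y) {V : (spec Y).Opens}
    {U : (spec X).Opens} (e : U ≤ φ.spec ⁻¹ᵁ V) (e' : φ.spec ⁻¹ᵁ V ≤ U) (h : Y)
    (hV : V = principal Y h)
    (hs : ∀ F : X, ∃ (N : ℕ) (q : Y), φ.comorphism q = φ.comorphism h ^ N * F) :
    IsClosedImmersion (φ.spec.resLE V U e) := by
  obtain rfl : U = φ.spec ⁻¹ᵁ V := le_antisymm e e'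
  subst hV
  rw [Scheme.Hom.resLE_eq_morphismRestrict]
  refine (MorphismProperty.arrow_mk_iso_iff @IsClosedImmersion
    (SpecMapRestrictBasicOpenIso (CommRingCat.ofHom φ.comorphism.toRingHom) h)).2 ?_
  refine IsClosedImmersion.spec_of_surjective _ ?_
  refine (Localization.awayMap_surjective_iff (f := φ.comorphism.toRingHom)).2 ?_
  intro F
  obtain ⟨N, q, hq⟩ := hs F
  exact ⟨q, N, hq⟩

theorem preimage_principal (φ : Mor X Y) (h : Y) :
    φ.spec ⁻¹ᵁ principal Y h = principal X (φ.comorphism h) := rfl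

theorem principal_mul (f g : X) : principal X (f * g) = principal X f ⊓ principal X g :=
  PrimeSpectrum.basicOpen_mul f g

theorem preimage_inf {S T : Scheme.{u}} (φ : S ⟶ T) (V W : T.Opens) :
    φ ⁻¹ᵁ (V ⊓ W) = φ ⁻¹ᵁ V ⊓ φ ⁻¹ᵁ W := rfl

/-- A finite intersection of principal opens is principal. -/
theorem exists_principal_iInf {ι : Type} [Finite ι] {V : ι → (spec X).Opens}
    (hV : ∀ i, ∃ f, V i = principal X f) : ∃ f, ⨅ i, V i = principal X f := by
  choose f hf using hV
  cases nonempty_fintype ι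
  refine ⟨∏ i, f i, ?_⟩
  obtain rfl : V = fun i => principal X (f i) := funext hf
  classical
  suffices H : ∀ s : Finset ι, ⨅ i ∈ s, principal X (f i) = principal X (∏ i ∈ s, f i) by
    simpa using H Finset.univ
  intro s
  induction s using Finset.induction_on with
  | empty =>
    rw [Finset.prod_empty]
    have : principal X 1 = ⊤ := PrimeSpectrum.basicOpen_one
    simp [this]
  | insert a s ha ih => rw [Finset.iInf_insert, Finset.prod_insert ha, principal_mul, ih]

theorem exists_principal_inf {V W : (spec X).Opens} (hV : ∃ f, V = principal X f)
    (hW : ∃ f, W = principal X f) : ∃ f, V ⊓ W = principal X f := by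
  obtain ⟨f, rfl⟩ := hV
  obtain ⟨g, rfl⟩ := hW
  exact ⟨f * g, (principal_mul f g).symm⟩

theorem exists_principal_preimage (φ : Mor X Y) {V : (spec Y).Opens}
    (hV : ∃ f, V = principal Y f) : ∃ f, φ.spec ⁻¹ᵁ V = principal X f := by
  obtain ⟨f, rfl⟩ := hV
  exact ⟨_, preimage_principal φ f⟩

theorem preimage_iInf {ι : Type} [Finite ι] (φ : Mor X Y) (V : ι → (spec Y).Opens) :
    φ.spec ⁻¹ᵁ (⨅ i, V i) = ⨅ i, φ.spec ⁻¹ᵁ V i := by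
  cases nonempty_fintype ι
  classical
  suffices H : ∀ s : Finset ι, φ.spec ⁻¹ᵁ (⨅ i ∈ s, V i) = ⨅ i ∈ s, φ.spec ⁻¹ᵁ V i by
    simpa using H Finset.univ
  intro s
  induction s using Finset.induction_on with
  | empty => simp
  | insert a s ha ih => rw [Finset.iInf_insert, Finset.iInf_insert, preimage_inf, ih]

theorem dvd_pow_of_principal_le {f h : Y} (hle : principal Y h ≤ principal Y f) :
    ∃ N, f ∣ h ^ N := by
  obtain ⟨N, hN⟩ := (PrimeSpectrum.basicOpen_le_basicOpen_iff h f).1 hle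
  exact ⟨N, Ideal.mem_span_singleton.1 hN⟩

/-- The points of `X` whose image lies in `h ≠ 0`. -/
abbrev Locus (φ : Mor X Y) (h : Y) : Type u := {x : P // h.1 (φ.map x) ≠ 0}

/-- The functions `q ∘ φ / (h ∘ φ) ^ N` with `q ∈ k[Y]`. -/
def pullbackAlg (φ : Mor X Y) (h : Y) : AffVar k (Locus φ h) where
  carrier := {f | ∃ (N : ℕ) (q : Y), ∀ x, h.1 (φ.map x.1) ^ N * f x = q.1 (φ.map x.1)}
  mul_mem' := by
    rintro a b ⟨N, p, hp⟩ ⟨M, q, hq⟩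
    refine ⟨N + M, p * q, fun x => ?_⟩
    change _ = p.1 _ * q.1 _
    rw [← hp, ← hq, Pi.mul_apply]; ring
  add_mem' := by
    rintro a b ⟨N, p, hp⟩ ⟨M, q, hq⟩
    refine ⟨N + M, h ^ M * p + h ^ N * q, fun x => ?_⟩
    change _ = (h.1 _) ^ M * p.1 _ + (h.1 _) ^ N * q.1 _
    rw [← hp, ← hq, Pi.add_apply]; ring
  algebraMap_mem' r := ⟨0, algebraMap k Y r, fun x => by rw [pow_zero, one_mul]; rfl⟩

variable {φ : Mor X Y} {h : Y}

theorem pullback_mem (q : Y) : (fun x : Locus φ h => q.1 (φ.map x.1)) ∈ pullbackAlg φ h :=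
  ⟨0, q, fun x => by simp⟩

/-- If `f` vanishes nowhere on `h ≠ 0`, then `f` divides some `h ^ N`, and the cofactor divided by
`h ^ N` is the inverse of `f`. -/
theorem pullback_inv_mem {f : Y} (hle : principal Y h ≤ principal Y f) :
    (fun x : Locus φ h => (f.1 (φ.map x.1))⁻¹) ∈ pullbackAlg φ h ∧
      ∀ x : Locus φ h, f.1 (φ.map x.1) ≠ 0 := by
  obtain ⟨N, g, hg⟩ := dvd_pow_of_principal_le hle
  have H : ∀ y, h.1 y ^ N = f.1 y * g.1 y := fun y => congrFun (congrArg Subtype.val hg) y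
  have H' : ∀ x : Locus φ h, f.1 (φ.map x.1) ≠ 0 := fun x hx =>
    pow_ne_zero N x.2 (by rw [H, hx, zero_mul])
  refine ⟨⟨N, g, fun x => ?_⟩, H'⟩
  rw [H, mul_comm (f.1 _), mul_assoc, mul_inv_cancel₀ (H' x), mul_one]

/-- Passes from an identity on the points of the locus back to an identity of functions on all of
`X`. -/
theorem exists_pullback_eq (F : X)
    (hF : (fun x : Locus φ h => F.1 x.1) ∈ pullbackAlg φ h) :
    ∃ (N : ℕ) (q : Y), φ.comorphism q = φ.comorphism h ^ N * F := by
  obtain ⟨N, q, hq⟩ := hF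
  -- The extra factor `h` makes both sides vanish at the points where `h ∘ φ = 0`, about which the
  -- hypothesis says nothing.
  refine ⟨N + 1, h * q, Subtype.ext (funext fun x => ?_)⟩
  change h.1 (φ.map x) * q.1 (φ.map x) = h.1 (φ.map x) ^ (N + 1) * F.1 x
  by_cases hx : h.1 (φ.map x) = 0
  · simp [hx]
  · rw [← hq ⟨x, hx⟩]; ring

end LocalizedPullback

/-! ### Bordered matrices, maximal minors and determinant normalization -/

section Border

variable {k : Type u} [Field k] {n : Type} {j : ℕ}

/-- The matrix `K` with the additional last row `x`. -/
def border (K : Matrix (Fin j) n k) (x : n → k) : Matrix (Fin (j + 1)) n k :=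
  Matrix.of (Fin.snoc (α := fun _ => n → k) K x)

omit [Field k] in
@[simp] theorem border_castSucc (K : Matrix (Fin j) n k) (x : n → k) (a : Fin j) (b : n) :
    border K x a.castSucc b = K a b :=
  congrFun (Fin.snoc_castSucc (α := fun _ => n → k) x K a) b

omit [Field k] in
@[simp] theorem border_last (K : Matrix (Fin j) n k) (x : n → k) (b : n) :
    border K x (Fin.last j) b = x b :=
  congrFun (Fin.snoc_last (α := fun _ => n → k) x K) b

theorem border_mul {p : Type} [Fintype n] (K : Matrix (Fin j) n k) (x : n → k)
    (N : Matrix n p k) : border K x * N = border (K * N) (x ᵥ* N) := by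
  ext a b
  induction a using Fin.lastCases with
  | last => simp [Matrix.mul_apply, Matrix.vecMul, dotProduct]
  | cast a => simp [Matrix.mul_apply]

/-- The block diagonal matrix with blocks `S` and `1`. -/
def augment (S : Matrix (Fin j) (Fin j) k) : Matrix (Fin (j + 1)) (Fin (j + 1)) k :=
  (Matrix.fromBlocks S 0 0 (1 : Matrix (Fin 1) (Fin 1) k)).submatrix
    finSumFinEquiv.symm finSumFinEquiv.symm

theorem det_augment (S : Matrix (Fin j) (Fin j) k) : (augment S).det = S.det := by
  rw [augment, Matrix.det_submatrix_equiv_self, Matrix.det_fromBlocks_zero₂₁, Matrix.det_one,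
    mul_one]

theorem augment_apply (S : Matrix (Fin j) (Fin j) k) (a b : Fin j) :
    augment S a.castSucc b.castSucc = S a b ∧ augment S a.castSucc (Fin.last j) = 0 ∧
      augment S (Fin.last j) a.castSucc = 0 := by
  have hl : Fin.last j = Fin.natAdd j (0 : Fin 1) := rfl
  have hc : ∀ c : Fin j, c.castSucc = Fin.castAdd 1 c := fun _ => rfl
  simp only [augment, hl, hc, Matrix.submatrix_apply, finSumFinEquiv_symm_apply_castAdd,
    finSumFinEquiv_symm_apply_natAdd]
  simp

theorem augment_last_last (S : Matrix (Fin j) (Fin j) k) :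
    augment S (Fin.last j) (Fin.last j) = 1 := by
  have hl : Fin.last j = Fin.natAdd j (0 : Fin 1) := rfl
  simp only [augment, hl, Matrix.submatrix_apply, finSumFinEquiv_symm_apply_natAdd]
  simp

theorem border_mul_left (S : Matrix (Fin j) (Fin j) k) (K : Matrix (Fin j) n k) (x : n → k) :
    border (S * K) x = augment S * border K x := by
  ext a b
  induction a using Fin.lastCases with
  | last =>
    simp [Matrix.mul_apply, Fin.sum_univ_castSucc, augment_last_last,
      fun c : Fin j => (augment_apply S c c).2.2]
  | cast a =>
    simp [Matrix.mul_apply, Fin.sum_univ_castSucc, (augment_apply S a a).2.1,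
      fun c : Fin j => (augment_apply S a c).1]

theorem det_border_mul (S : Matrix (Fin j) (Fin j) k) (K : Matrix (Fin j) (Fin (j + 1)) k)
    (x : Fin (j + 1) → k) : (border (S * K) x).det = S.det * (border K x).det := by
  rw [border_mul_left, Matrix.det_mul, det_augment]

/-- The determinant is linear in its `i`-th row, so it is determined by its values on the standard
basis vectors. -/
theorem det_updateRow_eq_dotProduct {r : Type} [Fintype r] [DecidableEq r] (M : Matrix r r k)
    (i : r) (x : r → k) :
    (M.updateRow i x).det = x ⬝ᵥ fun a => (M.updateRow i (Pi.single a 1)).det := by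
  have h := LinearMap.pi_apply_eq_sum_univ
    ((Matrix.detRowAlternating (R := k) (n := r)).toMultilinearMap.toLinearMap M i) x
  refine h.trans (Finset.sum_congr rfl fun a _ => ?_)
  rw [smul_eq_mul]
  congr 1
  change Matrix.det (Function.update M i _) = Matrix.det (Function.update M i _)
  congr 2
  ext b
  simp [Pi.single_apply, eq_comm]

/-- The vector of signed maximal minors. -/
def cof (K : Matrix (Fin j) (Fin (j + 1)) k) : Fin (j + 1) → k :=
  fun a => (border K (Pi.single a 1)).det

theorem dotProduct_cof (K : Matrix (Fin j) (Fin (j + 1)) k) (x : Fin (j + 1) → k) :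
    x ⬝ᵥ cof K = (border K x).det := by
  -- Bordering by `z` is a row update of a matrix independent of `z`, so linearity in the row
  -- applies.
  have h : ∀ z, border K z = (border K 0).updateRow (Fin.last j) z := by
    intro z
    ext a b
    induction a using Fin.lastCases with
    | last => simp
    | cast a => simp
  rw [h, det_updateRow_eq_dotProduct]
  simp only [← h]
  rfl

/-- The inclusion matrix `[1 | 0]`. -/
def incl (k : Type u) [Field k] (i : ℕ) : Matrix (Fin i) (Fin (i + 1)) k :=
  Matrix.of fun a b => if a.val = b.val then 1 else 0

@[simp] theorem mul_incl_castSucc (M : Matrix n (Fin j) k) (a : n) (b : Fin j) :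
    (M * incl k j) a b.castSucc = M a b := by
  simp [Matrix.mul_apply, incl, ← Fin.ext_iff]

@[simp] theorem mul_incl_last (M : Matrix n (Fin j) k) (a : n) :
    (M * incl k j) a (Fin.last j) = 0 := by
  simp only [Matrix.mul_apply, incl, Matrix.of_apply, Fin.val_last]
  exact Finset.sum_eq_zero fun c _ => by rw [if_neg c.2.ne, mul_zero]

theorem det_border_incl (z : Fin (j + 1) → k) : (border (incl k j) z).det = z (Fin.last j) := by
  rw [Matrix.det_of_isLowerTriangular]
  · rw [Fin.prod_univ_castSucc]
    simp [incl]
  · intro a b hab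
    induction a using Fin.lastCases with
    | last => exact absurd hab (not_lt.2 (Fin.le_last b))
    | cast a =>
      simp only [border_castSucc, incl, Matrix.of_apply]
      exact if_neg fun h => absurd hab (by simp [Fin.lt_def, ← h])

/-- The `j` independent rows span a proper subspace of a space of dimension `j + 1`; any `y` outside
it completes them to a basis. -/
theorem exists_det_border_ne_zero (K : Matrix (Fin j) (Fin (j + 1)) k)
    (hK : ∀ v, v ᵥ* K = 0 → v = 0) : ∃ y, (border K y).det ≠ 0 := by
  have hli : LinearIndependent k K.row := by
    rw [← Matrix.vecMul_injective_iff]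
    exact (injective_iff_map_eq_zero K.vecMulLinear).2 hK
  have hlt : Submodule.span k (Set.range K.row) ≠ ⊤ := by
    intro h
    have := finrank_span_eq_card hli
    rw [h, finrank_top] at this
    simp at this
  obtain ⟨y, -, hy⟩ := SetLike.exists_of_lt (lt_top_iff_ne_top.2 hlt)
  refine ⟨y, ?_⟩
  have h2 : LinearIndependent k (border K y).row :=
    (linearIndependent_finSnoc (v := K.row)).2 ⟨hli, hy⟩
  rw [Matrix.linearIndependent_rows_iff_isUnit, Matrix.isUnit_iff_isUnit_det] at h2
  exact h2.ne_zero

/-- The diagonal matrix `diag(1, …, 1, c)`. -/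
def lastDiag (i : ℕ) (c : k) : Matrix (Fin i) (Fin i) k :=
  Matrix.diagonal fun a => if a.val + 1 = i then c else 1

theorem lastDiag_mul (i : ℕ) (c d : k) : lastDiag i c * lastDiag i d = lastDiag i (c * d) := by
  rw [lastDiag, lastDiag, Matrix.diagonal_mul_diagonal, lastDiag]
  congr 1
  ext a
  split_ifs <;> simp

theorem lastDiag_one (i : ℕ) : lastDiag i (1 : k) = 1 := by
  simp [lastDiag]

theorem det_lastDiag (i : ℕ) (c : k) : (lastDiag i c).det = if i = 0 then 1 else c := by
  rw [lastDiag, Matrix.det_diagonal]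
  cases i with
  | zero => simp
  | succ i =>
    rw [Fin.prod_univ_castSucc, Finset.prod_eq_one]
    · simp
    · intro a _
      rw [if_neg]
      simp [a.2.ne]

/-- Only the last column is rescaled, and that column of `[1 | 0]` is zero. Hence rescaling a base
change at `i + 1` to determinant one does not affect the normal form of the `i`-th arrow. -/
theorem incl_mul_lastDiag (i : ℕ) (c : k) : incl k i * lastDiag (i + 1) c = incl k i := by
  ext a b
  rw [lastDiag, Matrix.mul_diagonal, incl, Matrix.of_apply]
  split_ifs with h1 h2
  · have := a.2; omega
  · simp
  · simp
  · simp

end Border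

/-! ### Frames of generic pairs and their equivariance -/

section Frames

variable {k : Type u} [Field k] {l : ℕ}

/-- The square matrix with the rows of `M` above those of `N`. -/
def stackOf {i j : ℕ} (h : i + j = l) (M : Matrix (Fin i) (Fin l) k)
    (N : Matrix (Fin j) (Fin l) k) : Matrix (Fin l) (Fin l) k :=
  (Matrix.fromRows M N).submatrix ((finCongr h.symm).trans finSumFinEquiv.symm) id

theorem stackOf_mul {i j : ℕ} (h : i + j = l) (M : Matrix (Fin i) (Fin l) k)
    (N : Matrix (Fin j) (Fin l) k) (g : Matrix (Fin l) (Fin l) k) :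
    stackOf h (M * g) (N * g) = stackOf h M N * g := by
  rw [stackOf, ← Matrix.fromRows_mul]
  rfl

theorem det_stackOf_mul {i j : ℕ} (h : i + j = l) (S : Matrix (Fin i) (Fin i) k)
    (T : Matrix (Fin j) (Fin j) k) (M : Matrix (Fin i) (Fin l) k)
    (N : Matrix (Fin j) (Fin l) k) :
    (stackOf h (S * M) (T * N)).det = S.det * T.det * (stackOf h M N).det :=
  det_blockRows _ S T M N

theorem det_stackOf_border {i j : ℕ} (h : i + 1 + j = l) (K : Matrix (Fin i) (Fin l) k)
    (N : Matrix (Fin j) (Fin l) k) (x : Fin l → k) :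
    (stackOf h (border K x) N).det =
      x ⬝ᵥ fun a => (stackOf h (border K (Pi.single a 1)) N).det := by
  have H : ∀ z, stackOf h (border K z) N = (stackOf h (border K 0) N).updateRow
      (((finCongr h.symm).trans finSumFinEquiv.symm).symm (Sum.inl (Fin.last i))) z := by
    intro z
    ext a b
    obtain ⟨c, rfl⟩ := ((finCongr h.symm).trans finSumFinEquiv.symm).symm.surjective a
    rcases c with c | c
    · induction c using Fin.lastCases with
      | last =>
        rw [Matrix.updateRow_self, stackOf, Matrix.submatrix_apply, Equiv.apply_symm_apply]
        simp
      | cast c =>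
        rw [Matrix.updateRow_ne (by simp [(Fin.castSucc_lt_last c).ne]), stackOf, stackOf,
          Matrix.submatrix_apply, Matrix.submatrix_apply, Equiv.apply_symm_apply]
        simp
    · rw [Matrix.updateRow_ne (fun hc => by simpa using Equiv.injective _ hc), stackOf, stackOf,
        Matrix.submatrix_apply, Matrix.submatrix_apply, Equiv.apply_symm_apply]
      simp
  rw [H, det_updateRow_eq_dotProduct]
  simp only [← H]

/-- The frame attached to a flag and a dual flag: its `j`-th column spans the intersection of the
column space of `B(p̌_{j+1})` with the kernel of `A(p_j)`. -/
def mixedFrame (A : Flag k l) (B : DualFlag k l) : Matrix (Fin l) (Fin l) k :=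
  Matrix.of fun a j => (DualFlag.path B (j + 1) j.2 *ᵥ
    cof (Flag.path A j j.2.le * DualFlag.path B (j + 1) j.2)) a

/-- The frame attached to two flags: its `j`-th column spans the common kernel of `A₁(p_j)` and
`A₂(p_{l-1-j})`. -/
def flagFrame (A₁ A₂ : Flag k l) : Matrix (Fin l) (Fin l) k :=
  Matrix.of fun a j => (stackOf (show j.1 + 1 + (l - (j.1 + 1)) = l by omega)
    (border (Flag.path A₁ j j.2.le) (Pi.single a 1))
    (Flag.path A₂ (l - (j.1 + 1)) (Nat.sub_le _ _))).det

/-- Reading the frame through row vectors turns its columns into bordered determinants; equivariance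
and adaptedness are then multiplicativity of determinants. -/
theorem mixedFrame_apply (A : Flag k l) (B : DualFlag k l) (x : Fin l → k) (j : Fin l) :
    (x ᵥ* mixedFrame A B) j =
      (border (Flag.path A j j.2.le) x * DualFlag.path B (j + 1) j.2).det := by
  rw [border_mul, ← dotProduct_cof, ← Matrix.dotProduct_mulVec]
  rfl

theorem flagFrame_apply (A₁ A₂ : Flag k l) (x : Fin l → k) (j : Fin l) :
    (x ᵥ* flagFrame A₁ A₂) j = (stackOf (show j.1 + 1 + (l - (j.1 + 1)) = l by omega)
      (border (Flag.path A₁ j j.2.le) x)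
      (Flag.path A₂ (l - (j.1 + 1)) (Nat.sub_le _ _))).det := by
  rw [det_stackOf_border]
  rfl

theorem ext_vecMul {n p : Type} [Fintype n] [DecidableEq n] {M N : Matrix n p k}
    (h : ∀ x j, (x ᵥ* M) j = (x ᵥ* N) j) : M = N := by
  ext a j
  simpa using h (Pi.single a 1) j

/-- Base changes below the vertex `l` enter only through determinants, which are one. Separate `s`
and `t` let this give both the invariance under each copy of `SL_γ` and the equivariance under `G`.
-/
theorem mixedFrame_act (A : Flag k l) (B : DualFlag k l) (s t : SLBeta k l)
    (h : SLmat (s.at l le_rfl) * SLmat (t.at l le_rfl) = 1) :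
    mixedFrame (Flag.act A s) (DualFlag.act t B) =
      SLmat (t.at l le_rfl) * mixedFrame A B := by
  refine ext_vecMul fun x j => ?_
  rw [← Matrix.vecMul_vecMul, mixedFrame_apply, mixedFrame_apply, Flag.path_act,
    DualFlag.path_act, ← Matrix.mul_assoc, Matrix.det_mul, det_SLmat, mul_one,
    ← Matrix.mul_assoc, border_mul]
  rw [Matrix.mul_assoc _ _ (SLmat (t.at l le_rfl)), h, Matrix.mul_one, border_mul_left,
    Matrix.mul_assoc, Matrix.det_mul, det_augment, det_SLmat, one_mul]

theorem flagFrame_act (A₁ A₂ : Flag k l) (s t : SLBeta k l)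
    (h : s.at l le_rfl = t.at l le_rfl) :
    flagFrame (Flag.act A₁ s) (Flag.act A₂ t) =
      SLmat (s.at l le_rfl)⁻¹ * flagFrame A₁ A₂ := by
  refine ext_vecMul fun x j => ?_
  rw [← Matrix.vecMul_vecMul, flagFrame_apply, flagFrame_apply, Flag.path_act,
    Flag.path_act, ← h]
  -- Writing `x` as a multiple of the last component of `s` allows that component to be factored out
  -- of every row of the stacked matrix.
  have hx : x = (x ᵥ* SLmat (s.at l le_rfl)⁻¹) ᵥ* SLmat (s.at l le_rfl) := by
    rw [Matrix.vecMul_vecMul, SL_inv_mul, Matrix.vecMul_one]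
  conv_lhs => rw [hx]
  rw [← border_mul, stackOf_mul, Matrix.det_mul, det_SLmat, mul_one, border_mul_left,
    det_stackOf_mul, det_augment, det_SLmat, det_SLmat, one_mul, one_mul]

/-! ### Leading blocks and determinants of adapted frames -/

/-- The leading `i × i` block of `A(p_i) P`. -/
def leading (A : Flag k l) (P : Matrix (Fin l) (Fin l) k) (i : ℕ) (hi : i ≤ l) :
    Matrix (Fin i) (Fin i) k :=
  (Flag.path A i hi * P).submatrix id (Fin.castLE hi)

theorem leading_self (A : Flag k l) (P : Matrix (Fin l) (Fin l) k) :
    leading A P l le_rfl = P := by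
  rw [leading, Flag.path_self, Matrix.one_mul]
  rfl

/-- A frame is adapted to a flag if its `i`-th column, paired with the rows of `A(p_{i+1})`, gives
the multiple `s (i + 1)` of the vector of maximal minors of the `i`-th arrow. -/
def Adapted (A : Flag k l) (P : Matrix (Fin l) (Fin l) k) (s : ℕ → k) : Prop :=
  ∀ (i : ℕ) (hi : i < l) (y : Fin (i + 1) → k),
    (y ᵥ* (Flag.path A (i + 1) hi * P)) ⟨i, hi⟩ = (border (A ⟨i, hi⟩) y).det * s (i + 1)

theorem vecMul_leading_last {A : Flag k l} {P : Matrix (Fin l) (Fin l) k} (i : ℕ) (hi : i < l)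
    (y : Fin (i + 1) → k) : (y ᵥ* leading A P (i + 1) hi) (Fin.last i) =
      (y ᵥ* (Flag.path A (i + 1) hi * P)) ⟨i, hi⟩ := rfl

/-- This is how a frame trivializes the arrows. All columns but the last agree because `A(p_i)` is
the arrow times `A(p_{i+1})`; the last column vanishes because bordering the arrow by one of its own
rows repeats a row. -/
theorem Adapted.mul_leading {A : Flag k l} {P : Matrix (Fin l) (Fin l) k} {s : ℕ → k}
    (h : Adapted A P s) (i : ℕ) (hi : i < l) :
    A ⟨i, hi⟩ * leading A P (i + 1) hi = leading A P i hi.le * incl k i := by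
  ext a b
  induction b using Fin.lastCases with
  | last =>
    rw [mul_incl_last]
    have := h i hi (A ⟨i, hi⟩ a)
    rw [← vecMul_leading_last] at this
    refine this.trans ?_
    rw [Matrix.det_zero_of_row_eq (Fin.castSucc_lt_last a).ne, zero_mul]
    ext b
    simp
  | cast b =>
    rw [mul_incl_castSucc]
    change (A ⟨i, hi⟩ * (Flag.path A (i + 1) hi * P)) a _ = (Flag.path A i hi.le * P) a _
    rw [Flag.path_eq A i hi, Matrix.mul_assoc]
    rfl

/-- Border the arrow by a row `y` and multiply by the next leading block. By `mul_leading` the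
determinant of the product is that of the current block times a single last entry, which adaptedness
evaluates as the bordered determinant times `s (i + 1)`. Injectivity of the arrow supplies a `y` for
which that bordered determinant can be cancelled. -/
theorem Adapted.det_leading {A : Flag k l} {P : Matrix (Fin l) (Fin l) k} {s : ℕ → k}
    (h : Adapted A P s) (hA : ∀ (i : ℕ) (hi : i < l) v, v ᵥ* A ⟨i, hi⟩ = 0 → v = 0)
    (i : ℕ) (hi : i ≤ l) :
    (leading A P i hi).det = ∏ r ∈ Finset.range i, s (r + 1) := by
  induction i with
  | zero => simp
  | succ i ih =>
    obtain ⟨y, hy⟩ := exists_det_border_ne_zero _ (hA i hi)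
    have := congrArg Matrix.det (border_mul (A ⟨i, hi⟩) y (leading A P (i + 1) hi))
    rw [h.mul_leading, det_border_mul, det_border_incl, vecMul_leading_last, h i hi,
      Matrix.det_mul, ih] at this
    rw [Finset.prod_range_succ]
    refine mul_left_cancel₀ hy ?_
    rw [this]; ring

theorem Adapted.det_eq {A : Flag k l} {P : Matrix (Fin l) (Fin l) k} {s : ℕ → k}
    (h : Adapted A P s) (hA : ∀ (i : ℕ) (hi : i < l) v, v ᵥ* A ⟨i, hi⟩ = 0 → v = 0) :
    P.det = ∏ r ∈ Finset.range l, s (r + 1) := by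
  rw [← h.det_leading hA l le_rfl, leading_self]

theorem Flag.injective_of_path {A : Flag k l}
    (h : ∀ (i : ℕ) (hi : i < l) v, v ᵥ* Flag.path A i hi.le = 0 → v = 0)
    (i : ℕ) (hi : i < l) (v : Fin i → k) (hv : v ᵥ* A ⟨i, hi⟩ = 0) : v = 0 := by
  refine h i hi v ?_
  rw [Flag.path_eq A i hi, ← Matrix.vecMul_vecMul, hv, Matrix.zero_vecMul]

/-- The determinants `det (A(p_i) B(p̌_i))`. -/
def pairDet (A : Flag k l) (B : DualFlag k l) (i : ℕ) : k :=
  if hi : i ≤ l then (Flag.path A i hi * DualFlag.path B i hi).det else 1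

/-- The determinants `det [A₁(p_i); A₂(p_{l-i})]`. -/
def stackDet (A₁ A₂ : Flag k l) (i : ℕ) : k :=
  if hi : i ≤ l then (stackOf (Nat.add_sub_cancel' hi) (Flag.path A₁ i hi)
    (Flag.path A₂ (l - i) (Nat.sub_le _ _))).det else 1

theorem adapted_mixedFrame (A : Flag k l) (B : DualFlag k l) :
    Adapted A (mixedFrame A B) (pairDet A B) := by
  intro i hi y
  rw [← Matrix.vecMul_vecMul, mixedFrame_apply, pairDet, dif_pos (Nat.succ_le_of_lt hi), ← Matrix.det_mul,
    ← Matrix.mul_assoc, border_mul (A ⟨i, hi⟩), ← Flag.path_eq A i hi]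

theorem adapted_flagFrame (A₁ A₂ : Flag k l) :
    Adapted A₁ (flagFrame A₁ A₂) (stackDet A₁ A₂) := by
  intro i hi y
  rw [← Matrix.vecMul_vecMul, flagFrame_apply, stackDet, dif_pos (Nat.succ_le_of_lt hi)]
  have := det_stackOf_mul (Nat.add_sub_cancel' hi) (border (A₁ ⟨i, hi⟩) y) 1
    (Flag.path A₁ (i + 1) hi) (Flag.path A₂ (l - (i + 1)) (Nat.sub_le _ _))
  rw [Matrix.det_one, mul_one, Matrix.one_mul, border_mul, ← Flag.path_eq A₁ i hi] at this
  exact this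

theorem eq_zero_of_vecMul_mul {i n : ℕ} {M : Matrix (Fin i) (Fin n) k}
    {N : Matrix (Fin n) (Fin i) k} (h : (M * N).det ≠ 0) (v : Fin i → k) (hv : v ᵥ* M = 0) :
    v = 0 := by
  refine Matrix.eq_zero_of_vecMul_eq_zero h ?_
  rw [← Matrix.vecMul_vecMul, hv, Matrix.zero_vecMul]

theorem arrow_injective_of_pairDet {A : Flag k l} {B : DualFlag k l}
    (h : ∀ i < l, pairDet A B i ≠ 0) (i : ℕ) (hi : i < l) (v : Fin i → k)
    (hv : v ᵥ* A ⟨i, hi⟩ = 0) : v = 0 := by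
  refine Flag.injective_of_path (fun i hi v hv => ?_) i hi v hv
  have := h i hi
  rw [pairDet, dif_pos hi.le] at this
  exact eq_zero_of_vecMul_mul this v hv

theorem eq_zero_of_det_fromRows {a b n : Type} [Fintype a] [Fintype b] [Fintype n]
    [DecidableEq n] (e : n ≃ a ⊕ b) {M : Matrix a n k} {N : Matrix b n k}
    (h : ((Matrix.fromRows M N).submatrix e id).det ≠ 0) (v : a → k) (hv : v ᵥ* M = 0) :
    v = 0 := by
  have h2 : Sum.elim v (0 : b → k) ∘ e = 0 := by
    refine Matrix.eq_zero_of_vecMul_eq_zero h ?_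
    rw [Matrix.submatrix_vecMul_equiv, Function.comp_assoc, Equiv.self_comp_symm,
      Function.comp_id, Matrix.vecMul_fromRows]
    simp [hv]
  ext x
  simpa using congrFun h2 (e.symm (Sum.inl x))

theorem arrow_injective_of_stackDet {A₁ A₂ : Flag k l}
    (h : ∀ i < l, 0 < i → stackDet A₁ A₂ i ≠ 0) (i : ℕ) (hi : i < l) (v : Fin i → k)
    (hv : v ᵥ* A₁ ⟨i, hi⟩ = 0) : v = 0 := by
  refine Flag.injective_of_path (fun i hi v hv => ?_) i hi v hv
  -- Genericity of two flags imposes no condition at the vertex `0`, where the space of vectors is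
  -- trivial.
  rcases Nat.eq_zero_or_pos i with rfl | hpos
  · exact Subsingleton.elim _ _
  have := h i hi hpos
  rw [stackDet, dif_pos hi.le] at this
  exact eq_zero_of_det_fromRows _ this v hv

theorem det_mixedFrame {A : Flag k l} {B : DualFlag k l} (h : ∀ i < l, pairDet A B i ≠ 0) :
    (mixedFrame A B).det = ∏ r ∈ Finset.range l, pairDet A B (r + 1) :=
  (adapted_mixedFrame A B).det_eq (arrow_injective_of_pairDet h)

theorem det_flagFrame {A₁ A₂ : Flag k l} (h : ∀ i < l, 0 < i → stackDet A₁ A₂ i ≠ 0) :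
    (flagFrame A₁ A₂).det = ∏ r ∈ Finset.range l, stackDet A₁ A₂ (r + 1) :=
  (adapted_flagFrame A₁ A₂).det_eq (arrow_injective_of_stackDet h)

theorem pairDet_self (A : Flag k l) (B : DualFlag k l) : pairDet A B l = 1 := by
  rw [pairDet, dif_pos le_rfl, Flag.path_self, DualFlag.path_self, Matrix.one_mul, Matrix.det_one]

theorem pairDet_of_lt (A : Flag k l) (B : DualFlag k l) (i : Fin l) :
    pairDet A B i = (pairing i A B).det := by
  rw [pairDet, dif_pos i.2.le]; rfl

theorem stackDet_self (A₁ A₂ : Flag k l) : stackDet A₁ A₂ l = 1 := by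
  -- The complementary size `l - l` is generalized to a variable `j`, so that `j = 0` can be
  -- substituted in the dependent types.
  have h : ∀ (j : ℕ) (hj : j ≤ l) (e : l + j = l),
      stackOf e (Flag.path A₁ l le_rfl) (Flag.path A₂ j hj) = 1 := by
    intro j hj e
    obtain rfl : j = 0 := by omega
    rw [Flag.path_self]
    ext a b
    have : ((finCongr e.symm).trans finSumFinEquiv.symm) a = Sum.inl a := by
      rw [Equiv.trans_apply, Equiv.symm_apply_eq]
      rfl
    rw [stackOf, Matrix.submatrix_apply, this]
    rfl
  rw [stackDet, dif_pos le_rfl, h, Matrix.det_one]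

theorem stackDet_of_split (A₁ A₂ : Flag k l) (p : splits l) :
    stackDet A₁ A₂ p.1.1 = (stack p A₁ A₂).det := by
  have h : ∀ (j : ℕ) (hj : j ≤ l) (e : p.1.1 + j = l), stackOf e
      (Flag.path A₁ p.1.1 (splits_fst_lt p).le) (Flag.path A₂ j hj) = stack p A₁ A₂ := by
    intro j hj e
    obtain rfl : j = p.1.2 := by have := splits_add p; omega
    rfl
  rw [stackDet, dif_pos (splits_fst_lt p).le, h]

end Frames

/-! ### Regularity of frames and of the transition matrices between them -/

section Regularity

variable {k : Type u} [Field k] {l : ℕ}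

theorem Flag.act_one (A : Flag k l) : Flag.act A 1 = A := by
  funext i
  have h : ∀ j hj, (1 : SLBeta k l).at j hj = 1 := fun _ _ => rfl
  rw [Flag.act, h, h, inv_one, SLmat_one, SLmat_one, Matrix.one_mul, Matrix.mul_one]

theorem DualFlag.act_one (A : DualFlag k l) : DualFlag.act 1 A = A := by
  funext i
  have h : ∀ j hj, (1 : SLBeta k l).at j hj = 1 := fun _ _ => rfl
  rw [DualFlag.act, h, h, inv_one, SLmat_one, SLmat_one, Matrix.one_mul, Matrix.mul_one]

theorem border_entry_mem {P : Type u} {X : AffVar k P} {j : ℕ} {n : Type}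
    {K : P → Matrix (Fin j) n k} {x : P → n → k} (hK : ∀ a b, (fun p => K p a b) ∈ X)
    (hx : ∀ b, (fun p => x p b) ∈ X) (a : Fin (j + 1)) (b : n) :
    (fun p => border (K p) (x p) a b) ∈ X := by
  induction a using Fin.lastCases with
  | last => simpa only [border_last] using hx b
  | cast a => simpa only [border_castSucc] using hK a b

theorem adjugate_entry_mem {P : Type u} {X : AffVar k P} {n : Type} [Fintype n] [DecidableEq n]
    {M : P → Matrix n n k} (h : ∀ a b, (fun p => M p a b) ∈ X) (a b : n) :
    (fun p => (M p).adjugate a b) ∈ X := by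
  simp only [Matrix.adjugate_apply]
  refine det_mem fun i j => ?_
  by_cases hi : i = b
  · subst hi
    simp only [Matrix.updateRow_self]
    exact X.algebraMap_mem _
  · simp only [Matrix.updateRow_ne hi]
    exact h i j

theorem mixedFrame_entry_mem (a j : Fin l) :
    (fun p : Flag k l × DualFlag k l => mixedFrame p.1 p.2 a j) ∈
      prodVar (flags k l) (dualFlags k l) := by
  -- Each entry is a single determinant in the path matrices, hence polynomial.
  have key : ∀ (A : Flag k l) (B : DualFlag k l), mixedFrame A B a j =
      (border (Flag.path A j j.2.le) (Pi.single a 1) * DualFlag.path B (j + 1) j.2).det :=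
    fun A B => by rw [← mixedFrame_apply, Matrix.single_one_vecMul]; rfl
  refine mem_quot_prod_quot ?_ ?_ ?_
  · simp only [key]
    exact det_mem fun c d => mul_entry_mem
      (border_entry_mem (fun _ _ => fst_mem (Flag.path_entry_mem _ _ _ _))
        fun _ => Subalgebra.algebraMap_mem _ _)
      (fun _ _ => snd_mem (DualFlag.path_entry_mem _ _ _ _)) c d
  · intro s A B
    have := mixedFrame_act A B s.1 1 (by
      rw [s.2, SLmat_one, Matrix.one_mul]; exact SLmat_one)
    rw [DualFlag.act_one] at this
    exact congrFun (congrFun (this.trans (by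
      rw [show (1 : SLBeta k l).at l le_rfl = 1 from rfl, SLmat_one, Matrix.one_mul])) a) j
  · intro s A B
    have := mixedFrame_act A B 1 s.1 (by
      rw [s.2, SLmat_one, Matrix.mul_one]; exact SLmat_one)
    rw [Flag.act_one, s.2, SLmat_one, Matrix.one_mul] at this
    exact congrFun (congrFun this a) j

theorem stackOf_entry_mem {P : Type u} {X : AffVar k P} {i j : ℕ} (h : i + j = l)
    {M : P → Matrix (Fin i) (Fin l) k} {N : P → Matrix (Fin j) (Fin l) k}
    (hM : ∀ a b, (fun p => M p a b) ∈ X) (hN : ∀ a b, (fun p => N p a b) ∈ X) (a b : Fin l) :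
    (fun p => stackOf h (M p) (N p) a b) ∈ X := by
  simp only [stackOf, Matrix.submatrix_apply]
  rcases ((finCongr h.symm).trans finSumFinEquiv.symm) a with c | c
  · exact hM c b
  · exact hN c b

theorem flagFrame_entry_mem (a j : Fin l) :
    (fun p : Flag k l × Flag k l => flagFrame p.1 p.2 a j) ∈
      prodVar (flags k l) (flags k l) := by
  refine mem_quot_prod_quot ?_ ?_ ?_
  · exact det_mem fun c d => stackOf_entry_mem _
      (border_entry_mem (fun _ _ => fst_mem (Flag.path_entry_mem _ _ _ _))
        fun _ => Subalgebra.algebraMap_mem _ _)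
      (fun _ _ => snd_mem (Flag.path_entry_mem _ _ _ _)) c d
  · intro s A B
    have := flagFrame_act A B s.1 1 s.2
    rw [Flag.act_one, s.2, inv_one, SLmat_one, Matrix.one_mul] at this
    exact congrFun (congrFun this a) j
  · intro s A B
    have := flagFrame_act A B 1 s.1 s.2.symm
    rw [Flag.act_one, show (1 : SLBeta k l).at l le_rfl = 1 from rfl, inv_one, SLmat_one,
      Matrix.one_mul] at this
    exact congrFun (congrFun this a) j

/-! ### Transposition and the frame of two dual flags -/

/-- The flag of transposed matrices. -/
def DualFlag.transpose (B : DualFlag k l) : Flag k l := fun i => (B i)ᵀ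

theorem DualFlag.transpose_path (B : DualFlag k l) (i : ℕ) (hi : i ≤ l) :
    Flag.path B.transpose i hi = (DualFlag.path B i hi)ᵀ := by
  refine Nat.decreasingInduction (motive := fun i hi => Flag.path B.transpose i hi =
    (DualFlag.path B i hi)ᵀ) ?_ ?_ hi
  · intro i h ih
    rw [Flag.path_eq _ i h, DualFlag.path_eq _ i h, ih, Matrix.transpose_mul]
    rfl
  · rw [Flag.path_self, DualFlag.path_self, Matrix.transpose_one]

/-- Componentwise transposition. -/
def SLBeta.transpose (s : SLBeta k l) : SLBeta k l := fun i => (s i).transpose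

theorem SLBeta.transpose_at (s : SLBeta k l) (i : ℕ) (hi : i ≤ l) :
    s.transpose.at i hi = (s.at i hi).transpose := rfl

theorem SLmat_transpose {n : ℕ} (g : SpecialLinearGroup (Fin n) k) :
    SLmat g.transpose = (SLmat g)ᵀ := rfl

theorem SLmat_transpose_inv {n : ℕ} (g : SpecialLinearGroup (Fin n) k) :
    SLmat (g.transpose)⁻¹ = (SLmat g⁻¹)ᵀ := by
  have h : SLmat (g.transpose) * (SLmat g⁻¹)ᵀ = 1 := by
    rw [SLmat_transpose, ← Matrix.transpose_mul, SL_inv_mul, Matrix.transpose_one]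
  rw [← Matrix.mul_one (SLmat (g.transpose)⁻¹), ← h, ← Matrix.mul_assoc, SL_inv_mul,
    Matrix.one_mul]

theorem DualFlag.transpose_act (B : DualFlag k l) (s : SLBeta k l) :
    (DualFlag.act s B).transpose = Flag.act B.transpose s.transpose := by
  funext i
  rw [DualFlag.transpose, DualFlag.act, Flag.act, Matrix.transpose_mul, Matrix.transpose_mul,
    SLBeta.transpose_at, SLBeta.transpose_at, SLmat_transpose_inv, SLmat_transpose,
    Matrix.mul_assoc]
  rfl

variable (k l) in
/-- Transposition as a morphism. -/
def transposeMor : Mor (dualFlags k l) (flags k l) :=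
  Mor.quotMap (X := dualFlagVar k l) (Y := flagVar k l)
    ⟨DualFlag.transpose, Mor.coordVar_regular fun c => dualFlag_entry_mem c.1 c.2.2 c.2.1⟩
    fun s B => ⟨⟨s.1.transpose, by
      rw [SLBeta.transpose_at, s.2]; exact Subtype.ext Matrix.transpose_one⟩,
      DualFlag.transpose_act B s.1⟩

variable (k l) in
/-- Transposition of pairs, as a morphism. -/
def transposePair : Mor (X02 k l) (X20 k l) :=
  Mor.quotMap (X := prodVar (dualFlags k l) (dualFlags k l))
    (Y := prodVar (flags k l) (flags k l))
    (Mor.pair ((transposeMor k l).comp (Mor.fst _ _)) ((transposeMor k l).comp (Mor.snd _ _)))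
    fun g p => by
      -- The quotient by `G` uses the inverse on flags, so transposing the left action of `g` gives
      -- the action of the inverse transpose.
      refine ⟨(g.transpose)⁻¹, ?_⟩
      have h : ∀ B : DualFlag k l, (DualFlag.gMul g B).transpose =
          Flag.mulG B.transpose ((g.transpose)⁻¹)⁻¹ := by
        intro B
        rw [DualFlag.gMul, DualFlag.transpose_act, Flag.mulG, inv_inv]
        congr 1
        refine SLBeta.ext fun i hi => ?_
        rw [SLBeta.transpose_at]
        rcases hi.lt_or_eq with h | rfl
        · rw [atLast_at_lt _ _ h, atLast_at_lt _ _ h]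
          exact Subtype.ext Matrix.transpose_one
        · rw [atLast_at_self, atLast_at_self]
      exact Prod.ext (h p.1) (h p.2)

/-- The frame attached to two dual flags: the adjugate of the transposed frame of the transposed
flags. -/
def dualFrame (B₁ B₂ : DualFlag k l) : Matrix (Fin l) (Fin l) k :=
  (flagFrame B₁.transpose B₂.transpose)ᵀ.adjugate

theorem dualFrame_entry_mem (a j : Fin l) :
    (fun p : DualFlag k l × DualFlag k l => dualFrame p.1 p.2 a j) ∈
      prodVar (dualFlags k l) (dualFlags k l) := by
  refine adjugate_entry_mem (M := fun p : DualFlag k l × DualFlag k l =>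
    (flagFrame p.1.transpose p.2.transpose)ᵀ) (fun c d => ?_) a j
  exact (Mor.pair ((transposeMor k l).comp (Mor.fst _ _))
    ((transposeMor k l).comp (Mor.snd _ _))).regular _ (flagFrame_entry_mem d c)

theorem adjugate_SLmat {n : ℕ} (g : SpecialLinearGroup (Fin n) k) :
    (SLmat g).adjugate = SLmat g⁻¹ :=
  (Matrix.SpecialLinearGroup.coe_inv g).symm

theorem mixedFrame_gMul (A : Flag k l) (B : DualFlag k l) (g : G k l) :
    mixedFrame (Flag.mulG A g⁻¹) (DualFlag.gMul g B) = SLmat g * mixedFrame A B := by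
  rw [Flag.mulG, DualFlag.gMul, mixedFrame_act, atLast_at_self]
  rw [atLast_at_self, atLast_at_self, SL_inv_mul]

theorem flagFrame_mulG (A₁ A₂ : Flag k l) (g : G k l) :
    flagFrame (Flag.mulG A₁ g⁻¹) (Flag.mulG A₂ g⁻¹) = SLmat g * flagFrame A₁ A₂ := by
  rw [Flag.mulG, Flag.mulG, flagFrame_act _ _ _ _ rfl, atLast_at_self, inv_inv]

/-- The frame of the transposed flags is multiplied by the inverse transpose of `g`. Transposing and
taking the adjugate restores left multiplication by `g`, without dividing by a determinant. -/
theorem dualFrame_gMul (B₁ B₂ : DualFlag k l) (g : G k l) :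
    dualFrame (DualFlag.gMul g B₁) (DualFlag.gMul g B₂) = SLmat g * dualFrame B₁ B₂ := by
  rw [dualFrame, DualFlag.gMul, DualFlag.gMul, DualFlag.transpose_act, DualFlag.transpose_act,
    flagFrame_act _ _ _ _ rfl, SLBeta.transpose_at, atLast_at_self, SLmat_transpose_inv,
    Matrix.transpose_mul, Matrix.transpose_transpose, Matrix.adjugate_mul_distrib,
    adjugate_SLmat, inv_inv, dualFrame]

/-! ### Equivariant frames on quadruples -/

/-- An equivariant matrix-valued regular function on quadruples. -/
def IsFrame (M : Quad k l → Matrix (Fin l) (Fin l) k) : Prop :=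
  (∀ a b, (fun q => M q a b) ∈ quads k l) ∧ ∀ g q, M (Quad.act g q) = SLmat g * M q

theorem isFrame_mixed14 : IsFrame fun q : Quad k l => mixedFrame q.1.1 q.2.2 :=
  ⟨fun a b => (Mor.pair ((Mor.fst (flags k l) (flags k l)).comp (Mor.fst _ _))
    ((Mor.snd (dualFlags k l) (dualFlags k l)).comp (Mor.snd _ _))).regular _
    (mixedFrame_entry_mem a b), fun g q => mixedFrame_gMul q.1.1 q.2.2 g⟩

theorem isFrame_mixed23 : IsFrame fun q : Quad k l => mixedFrame q.1.2 q.2.1 :=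
  ⟨fun a b => (Mor.pair ((Mor.snd (flags k l) (flags k l)).comp (Mor.fst _ _))
    ((Mor.fst (dualFlags k l) (dualFlags k l)).comp (Mor.snd _ _))).regular _
    (mixedFrame_entry_mem a b), fun g q => mixedFrame_gMul q.1.2 q.2.1 g⟩

theorem isFrame_flag12 : IsFrame fun q : Quad k l => flagFrame q.1.1 q.1.2 :=
  ⟨fun a b => fst_mem (flagFrame_entry_mem a b), fun g q => flagFrame_mulG q.1.1 q.1.2 g⟩

theorem isFrame_dual43 : IsFrame fun q : Quad k l => dualFrame q.2.2 q.2.1 :=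
  ⟨fun a b => (Mor.pair ((Mor.snd (dualFlags k l) (dualFlags k l)).comp (Mor.snd _ _))
    ((Mor.fst (dualFlags k l) (dualFlags k l)).comp (Mor.snd _ _))).regular _
    (dualFrame_entry_mem a b), fun g q => dualFrame_gMul q.2.2 q.2.1 g⟩

/-- The factors `adj(g) = g⁻¹` and `g` cancel. The adjugate in place of the inverse keeps the
entries polynomial, so they descend to all of `X_{2,2}`. -/
theorem IsFrame.adjugate_mul_mem {M N : Quad k l → Matrix (Fin l) (Fin l) k} (hM : IsFrame M)
    (hN : IsFrame N) (a b : Fin l) : (fun q => ((M q).adjugate * N q) a b) ∈ X22 k l := by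
  refine mem_quotVar.2 ⟨mul_entry_mem (adjugate_entry_mem hM.1) hN.1 a b, fun g q => ?_⟩
  simp only [hM.2, hN.2, Matrix.adjugate_mul_distrib, adjugate_SLmat]
  rw [Matrix.mul_assoc, ← Matrix.mul_assoc (SLmat g⁻¹), SL_inv_mul, Matrix.one_mul]

/-! ### Matrices of regular functions on a set of points -/

variable {U : Type u} (B : AffVar k U)

/-- A regular function with a regular inverse. -/
def InvMem (f : U → k) : Prop := (∀ x, f x ≠ 0) ∧ f ∈ B ∧ (fun x => (f x)⁻¹) ∈ B

variable {B} in
theorem InvMem.prod {ι : Type} {s : Finset ι} {f : ι → U → k} (h : ∀ i ∈ s, InvMem B (f i)) :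
    InvMem B fun x => ∏ i ∈ s, f i x := by
  refine ⟨fun x => Finset.prod_ne_zero_iff.2 fun i hi => (h i hi).1 x, ?_, ?_⟩
  · have : (fun x => ∏ i ∈ s, f i x) = ∏ i ∈ s, f i := by
      ext x; simp
    rw [this]
    exact B.prod_mem fun i hi => (h i hi).2.1
  have : (fun x => (∏ i ∈ s, f i x)⁻¹) = ∏ i ∈ s, fun x => (f i x)⁻¹ := by
    ext x; simp
  rw [this]
  exact B.prod_mem fun i hi => (h i hi).2.2

variable {B} in
theorem InvMem.pow {f : U → k} (h : InvMem B f) (n : ℕ) : InvMem B fun x => f x ^ n := by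
  refine ⟨fun x => pow_ne_zero _ (h.1 x), B.pow_mem h.2.1 n, ?_⟩
  simp only [← inv_pow]
  exact B.pow_mem h.2.2 n

/-- `N = M C` with a regular matrix `C`. -/
def Transfer (M N : U → Matrix (Fin l) (Fin l) k) : Prop :=
  ∃ C : U → Matrix (Fin l) (Fin l) k, (∀ a b, (fun x => C x a b) ∈ B) ∧ ∀ x, N x = M x * C x

variable {B} {M N L : U → Matrix (Fin l) (Fin l) k}

theorem Transfer.refl : Transfer B M M :=
  ⟨fun _ => 1, fun _ _ => B.algebraMap_mem _, fun _ => (Matrix.mul_one _).symm⟩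

theorem Transfer.trans (h : Transfer B M N) (h' : Transfer B N L) : Transfer B M L := by
  obtain ⟨C, hC, h⟩ := h
  obtain ⟨D, hD, h'⟩ := h'
  exact ⟨fun x => C x * D x, mul_entry_mem hC hD, fun x => by rw [h', h, Matrix.mul_assoc]⟩

theorem Transfer.mul_left (g : U → G k l) (h : Transfer B M N) :
    Transfer B (fun x => SLmat (g x) * M x) (fun x => SLmat (g x) * N x) := by
  obtain ⟨C, hC, h⟩ := h
  exact ⟨C, hC, fun x => by simp only [h, Matrix.mul_assoc]⟩

theorem Transfer.of_mul_left (g : U → G k l)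
    (h : Transfer B (fun x => SLmat (g x) * M x) (fun x => SLmat (g x) * N x)) :
    Transfer B M N := by
  have := h.mul_left fun x => (g x)⁻¹
  simpa only [← Matrix.mul_assoc, SL_inv_mul, Matrix.one_mul] using this

/-- The transition matrix is `det(M)⁻¹ adj(M) N`, an invariant divided by a unit; only the frame `M`
has to be invertible. -/
theorem IsFrame.transfer {M N : Quad k l → Matrix (Fin l) (Fin l) k} (hM : IsFrame M)
    (hN : IsFrame N) (ψ : Mor B (X22 k l)) (h : InvMem B fun x => (M (ψ.map x)).det) :
    Transfer B (fun x => M (ψ.map x)) (fun x => N (ψ.map x)) := by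
  refine ⟨fun x => (M (ψ.map x)).det⁻¹ • ((M (ψ.map x)).adjugate * N (ψ.map x)), fun a b =>
    B.mul_mem h.2.2 (ψ.regular _ (hM.adjugate_mul_mem hN a b)), fun x => ?_⟩
  rw [Matrix.mul_smul, ← Matrix.mul_assoc, Matrix.mul_adjugate, Matrix.smul_mul, Matrix.one_mul,
    smul_smul, inv_mul_cancel₀ (h.1 x), one_smul]

theorem invMem_pairDet (ψ : Mor B (X11 k l)) (h : ∀ i, InvMem B fun x => (s11 i).1 (ψ.map x))
    (i : ℕ) (hi : i ≤ l) : InvMem B fun x => pairDet (ψ.map x).1 (ψ.map x).2 i := by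
  rcases hi.lt_or_eq with hi | rfl
  · have := h ⟨i, hi⟩
    simp only [pairDet_of_lt _ _ ⟨i, hi⟩]
    exact this
  · simp only [pairDet_self]
    exact ⟨fun _ => one_ne_zero, B.one_mem, by
      simp only [inv_one]
      exact B.one_mem⟩

theorem invMem_stackDet (ψ : Mor B (X20 k l)) (h : ∀ p, InvMem B fun x => (s20 p).1 (ψ.map x))
    (i : ℕ) (h0 : 0 < i) (hi : i ≤ l) :
    InvMem B fun x => stackDet (ψ.map x).1 (ψ.map x).2 i := by
  rcases hi.lt_or_eq with hi | rfl
  · have := h ⟨(i, l - i), by simp [splits]; omega⟩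
    convert this using 2 with x
    exact stackDet_of_split _ _ ⟨(i, l - i), by simp [splits]; omega⟩
  · simp only [stackDet_self]
    exact ⟨fun _ => one_ne_zero, B.one_mem, by
      simp only [inv_one]
      exact B.one_mem⟩

theorem invMem_det_mixedFrame (ψ : Mor B (X11 k l))
    (h : ∀ i, InvMem B fun x => (s11 i).1 (ψ.map x)) :
    InvMem B fun x => (mixedFrame (ψ.map x).1 (ψ.map x).2).det := by
  have H := invMem_pairDet ψ h
  simp only [fun x => det_mixedFrame fun i hi => (H i (le_of_lt hi)).1 x]
  exact InvMem.prod fun i hi => H _ (Finset.mem_range.1 hi)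

theorem invMem_det_flagFrame (ψ : Mor B (X20 k l))
    (h : ∀ p, InvMem B fun x => (s20 p).1 (ψ.map x)) :
    InvMem B fun x => (flagFrame (ψ.map x).1 (ψ.map x).2).det := by
  have H := invMem_stackDet ψ h
  simp only [fun x => det_flagFrame fun i hi h0 => (H i h0 (le_of_lt hi)).1 x]
  exact InvMem.prod fun i hi => H _ (Nat.succ_pos _) (Finset.mem_range.1 hi)

theorem stack_transpose (p : splits l) (B₁ B₂ : DualFlag k l) :
    stack p B₁.transpose B₂.transpose = (dualStack p B₁ B₂)ᵀ := by
  rw [stack, DualFlag.transpose_path, DualFlag.transpose_path, ← Matrix.transpose_fromCols,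
    dualStack, Matrix.transpose_submatrix]

theorem invMem_det_dualFrame (ψ : Mor B (X02 k l))
    (h : ∀ p, InvMem B fun x => (s02 p).1 (ψ.map x)) :
    InvMem B fun x => (dualFrame (ψ.map x).1 (ψ.map x).2).det := by
  have H := invMem_det_flagFrame ((transposePair k l).comp ψ) fun p => by
    convert h p using 2 with x
    change (stack p (ψ.map x).1.transpose (ψ.map x).2.transpose).det = _
    rw [stack_transpose, Matrix.det_transpose]
    rfl
  -- The determinant of an adjugate is a power of the determinant, so units go to units.
  simp only [dualFrame, Matrix.det_adjugate, Matrix.det_transpose]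
  exact H.pow _

end Regularity

/-! ### Normal forms of tuples -/

section NormalForm

variable {k : Type u} [Field k] {l : ℕ}

/-- The flag with arrows `diag(1, …, 1, d_i) [1 | 0]`. -/
def stdFlag (d : ℕ → k) : Flag k l := fun i => lastDiag i (d i) * incl k i

/-- The dual flag with arrows `[1 | 0]ᵀ diag(1, …, 1, e_i)`. -/
def stdDual (e : ℕ → k) : DualFlag k l := fun i => (incl k i)ᵀ * lastDiag i (e i)

/-- The matrix `W diag(1, …, 1, (det W)⁻¹)` of determinant one. -/
def normalize {i : ℕ} (W : Matrix (Fin i) (Fin i) k) (h : W.det ≠ 0) :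
    SpecialLinearGroup (Fin i) k :=
  ⟨W * lastDiag i W.det⁻¹, by
    rw [Matrix.det_mul, det_lastDiag]
    split_ifs with hi
    · subst hi; simp
    · exact mul_inv_cancel₀ h⟩

theorem SLmat_normalize {i : ℕ} (W : Matrix (Fin i) (Fin i) k) (h : W.det ≠ 0) :
    SLmat (normalize W h) = W * lastDiag i W.det⁻¹ := rfl

theorem lastDiag_inv_mul (i : ℕ) {c : k} (h : c ≠ 0) : lastDiag i c⁻¹ * lastDiag i c = 1 := by
  rw [lastDiag_mul, inv_mul_cancel₀ h, lastDiag_one]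

/-- The base change at the vertex `i` is the `i`-th leading block, rescaled in its last column to
determinant one. By `mul_leading` the arrow becomes `[1 | 0]`, up to the rescaling at its source,
which leaves `d i` in the last diagonal entry. -/
theorem Adapted.exists_act_eq {A : Flag k l} {P : Matrix (Fin l) (Fin l) k} {s d : ℕ → k}
    (h : Adapted A P s) (hd : ∀ i hi, (leading A P i hi).det = d i) (h0 : ∀ i ≤ l, d i ≠ 0)
    (hP : P.det ≠ 0) :
    ∃ σ : SLBeta k l, Flag.act A σ = stdFlag d ∧ σ.at l le_rfl = normalize P hP := by
  have h1 : ∀ i hi, (leading A P i hi).det ≠ 0 := fun i hi => hd i hi ▸ h0 i hi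
  refine ⟨fun i => normalize (leading A P i (Nat.le_of_lt_succ i.2)) (h1 _ _), ?_, ?_⟩
  · funext i
    rw [Flag.act]
    set σ : SLBeta k l := fun i => normalize (leading A P i (Nat.le_of_lt_succ i.2)) (h1 _ _)
    have h2 : A i * SLmat (σ.at (i + 1) i.2) = SLmat (σ.at i i.2.le) * stdFlag d i := by
      change A i * (leading A P (i + 1) i.2 * lastDiag (i + 1) _) =
        leading A P i i.2.le * lastDiag i _ * (lastDiag i (d i) * incl k i)
      rw [← Matrix.mul_assoc, h.mul_leading i i.2, Matrix.mul_assoc, incl_mul_lastDiag, hd,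
        ← Matrix.mul_assoc, Matrix.mul_assoc _ (lastDiag i _) (lastDiag i _),
        lastDiag_inv_mul i (h0 i i.2.le), Matrix.mul_one]
    rw [Matrix.mul_assoc, h2, ← Matrix.mul_assoc, SL_inv_mul, Matrix.one_mul]
  · refine Subtype.ext ?_
    change leading A P l _ * lastDiag l (leading A P l _).det⁻¹ = P * lastDiag l P.det⁻¹
    rw [leading_self]

/-- The coordinates of the first `i` columns of `mixedFrame A B` with respect to the columns of
`B(p̌_i)`. -/
def coframe (A : Flag k l) (B : DualFlag k l) : (i : ℕ) → i ≤ l → Matrix (Fin i) (Fin i) k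
  | 0, _ => 1
  | i + 1, hi => (border (B ⟨i, hi⟩ * coframe A B i (Nat.le_of_succ_le hi))ᵀ
      (cof (Flag.path A i (Nat.le_of_succ_le hi) * DualFlag.path B (i + 1) hi)))ᵀ

theorem coframe_mul_incl (A : Flag k l) (B : DualFlag k l) (i : ℕ) (hi : i < l) :
    coframe A B (i + 1) hi * (incl k i)ᵀ = B ⟨i, hi⟩ * coframe A B i hi.le := by
  ext a b
  have : (coframe A B (i + 1) hi * (incl k i)ᵀ) a b = coframe A B (i + 1) hi a b.castSucc := by
    rw [Matrix.mul_apply, Finset.sum_eq_single b.castSucc]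
    · simp [incl]
    · intro c _ hc
      rw [Matrix.transpose_apply, incl, Matrix.of_apply, if_neg, mul_zero]
      exact fun h => hc (Fin.ext h.symm)
    · exact fun h => absurd (Finset.mem_univ _) h
  rw [this, coframe, Matrix.transpose_apply, border_castSucc, Matrix.transpose_apply]

/-- The column of the frame added at each step is a combination of the columns of the current path
matrix by construction, and the earlier columns are carried along by the arrow. -/
theorem path_mul_coframe (A : Flag k l) (B : DualFlag k l) (i : ℕ) (hi : i ≤ l) :
    DualFlag.path B i hi * coframe A B i hi =
      (mixedFrame A B).submatrix id (Fin.castLE hi) := by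
  induction i with
  | zero => ext a b; exact b.elim0
  | succ i ih =>
    ext a b
    induction b using Fin.lastCases with
    | last =>
      have : ∀ c, coframe A B (i + 1) hi c (Fin.last i) =
          cof (Flag.path A i (Nat.le_of_succ_le hi) * DualFlag.path B (i + 1) hi) c := by
        intro c
        rw [coframe, Matrix.transpose_apply, border_last]
      rw [Matrix.mul_apply]
      simp only [this]
      rfl
    | cast b =>
      have h2 : ∀ c, coframe A B (i + 1) hi c b.castSucc =
          (B ⟨i, hi⟩ * coframe A B i (Nat.le_of_succ_le hi)) c b := by
        intro c
        rw [coframe, Matrix.transpose_apply, border_castSucc, Matrix.transpose_apply]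
      have := congrFun (congrFun (ih (Nat.le_of_succ_le hi)) a) b
      rw [DualFlag.path_eq B i hi, Matrix.mul_assoc, Matrix.mul_apply] at this
      rw [Matrix.mul_apply]
      simp only [h2]
      exact this

theorem pairDet_mul_det_coframe (A : Flag k l) (B : DualFlag k l) (i : ℕ) (hi : i ≤ l) :
    pairDet A B i * (coframe A B i hi).det = (leading A (mixedFrame A B) i hi).det := by
  rw [pairDet, dif_pos hi, ← Matrix.det_mul, Matrix.mul_assoc, path_mul_coframe]
  rfl

/-- The dual counterpart of `Adapted.exists_act_eq`, with the coframes in place of the leading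
blocks. At the vertex `l` the coframe is the mixed frame itself, so the same element of `G`
normalizes the flag and the dual flag. -/
theorem exists_dual_act_eq {A : Flag k l} {B : DualFlag k l} {e : ℕ → k}
    (he : ∀ i hi, (coframe A B i hi).det⁻¹ = e i) (h0 : ∀ i ≤ l, e i ≠ 0)
    (hP : (mixedFrame A B).det ≠ 0) :
    ∃ τ : SLBeta k l, DualFlag.act τ B = stdDual e ∧
      τ.at l le_rfl = (normalize (mixedFrame A B) hP)⁻¹ := by
  have h1 : ∀ i hi, (coframe A B i hi).det ≠ 0 := fun i hi hz =>
    h0 i hi (by rw [← he i hi, hz, _root_.inv_zero])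
  refine ⟨fun i => (normalize (coframe A B i (Nat.le_of_lt_succ i.2)) (h1 _ _))⁻¹, ?_, ?_⟩
  · funext i
    rw [DualFlag.act]
    set τ : SLBeta k l := fun i =>
      (normalize (coframe A B i (Nat.le_of_lt_succ i.2)) (h1 _ _))⁻¹
    have h2 : B i * SLmat (τ.at i i.2.le)⁻¹ = SLmat (τ.at (i + 1) i.2)⁻¹ * stdDual e i := by
      have h3 : ∀ j hj, (τ.at j hj)⁻¹ = normalize (coframe A B j hj) (h1 _ _) :=
        fun j hj => inv_inv _
      have h4 : lastDiag (i + 1) (coframe A B (i + 1) i.2).det⁻¹ * (incl k i)ᵀ =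
          (incl k i)ᵀ := by
        rw [← Matrix.transpose_inj, Matrix.transpose_mul, lastDiag, Matrix.diagonal_transpose,
          Matrix.transpose_transpose]
        exact incl_mul_lastDiag _ _
      rw [h3, h3, SLmat_normalize, SLmat_normalize, stdDual, ← Matrix.mul_assoc,
        ← coframe_mul_incl A B i i.2, he, Matrix.mul_assoc, Matrix.mul_assoc,
        ← Matrix.mul_assoc (lastDiag (i + 1) _), h4]
    rw [Matrix.mul_assoc, h2, ← Matrix.mul_assoc, SL_mul_inv, Matrix.one_mul]
  · have : coframe A B l le_rfl = mixedFrame A B := by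
      have := path_mul_coframe A B l le_rfl
      rw [DualFlag.path_self, Matrix.one_mul] at this
      exact this
    refine congrArg (·⁻¹) (Subtype.ext ?_)
    change coframe A B l _ * lastDiag l (coframe A B l _).det⁻¹ = _
    rw [this]
    rfl

/-- Removing its last component from a base change leaves an element of `SL_γ`; this separates the
action of `G` from that of `SL_γ`. -/
theorem Flag.exists_gamma (A : Flag k l) (σ : SLBeta k l) :
    ∃ s : SLGamma k l, Flag.act (Flag.mulG A (σ.at l le_rfl)) s.1 = Flag.act A σ := by
  refine ⟨⟨(atLast (σ.at l le_rfl))⁻¹ * σ, ?_⟩, ?_⟩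
  · change ((atLast (σ.at l le_rfl)).at l le_rfl)⁻¹ * σ.at l le_rfl = 1
    rw [atLast_at_self, inv_mul_cancel]
  · rw [Flag.mulG, ← Flag.act_mul, mul_inv_cancel_left]

theorem DualFlag.exists_gamma (B : DualFlag k l) (τ : SLBeta k l) :
    ∃ s : SLGamma k l, DualFlag.act s.1 (DualFlag.gMul (τ.at l le_rfl) B) =
      DualFlag.act τ B := by
  refine ⟨⟨τ * (atLast (τ.at l le_rfl))⁻¹, ?_⟩, ?_⟩
  · change τ.at l le_rfl * ((atLast (τ.at l le_rfl)).at l le_rfl)⁻¹ = 1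
    rw [atLast_at_self, mul_inv_cancel]
  · rw [DualFlag.gMul, ← DualFlag.act_mul, inv_mul_cancel_right]

theorem prodVar_invariant {P Q : Type u} {X : AffVar k P} {Y : AffVar k Q} {f : P → P}
    {g : Q → Q} (hf : ∀ a ∈ X, ∀ x, a (f x) = a x) (hg : ∀ b ∈ Y, ∀ y, b (g y) = b y)
    {F : P × Q → k} (hF : F ∈ prodVar X Y) (p : P × Q) : F (f p.1, g p.2) = F p := by
  obtain ⟨n, a, b, h⟩ := mem_prodVar_iff.1 hF
  rw [h, h]
  exact Finset.sum_congr rfl fun i _ => by rw [hf _ (a i).2, hg _ (b i).2]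

/-- Functions on `𝒜 × G^m × 𝒜̌` are finite sums of products of functions on the factors, and those
on `𝒜` and `𝒜̌` are invariant by definition. -/
theorem tups_invariant {m : ℕ} {F : Tup k l m → k} (hF : F ∈ tups k l m) (s s' : SLGamma k l)
    (t : Tup k l m) : F ((Flag.act t.1.1 s.1, t.1.2), DualFlag.act s'.1 t.2) = F t :=
  prodVar_invariant (X := prodVar (flags k l) (powVar (Finset.Icc 1 m) (groupVar k l)))
      (Y := dualFlags k l) (f := fun p : Flag k l × (Finset.Icc 1 m → G k l) =>
      (Flag.act p.1 s.1, p.2)) (g := fun B => DualFlag.act s'.1 B)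
    (fun _ ha p => prodVar_invariant (X := flags k l)
      (f := fun A => Flag.act A s.1) (g := id)
      (fun _ hb => hb.2 s) (fun _ _ _ => rfl) ha p)
    (fun _ hb => hb.2 s') hF t

/-- The products `d_i = s_1 ⋯ s_i` of the determinants `s_j = det (A(p_j) B(p̌_j))`. -/
def cumDet (A : Flag k l) (B : DualFlag k l) (i : ℕ) : k :=
  ∏ r ∈ Finset.range i, pairDet A B (r + 1)

theorem pairDet_ne_zero {A : Flag k l} {B : DualFlag k l} (h : ∀ i < l, pairDet A B i ≠ 0)
    (i : ℕ) (hi : i ≤ l) : pairDet A B i ≠ 0 := by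
  rcases hi.lt_or_eq with hi | rfl
  · exact h i hi
  · rw [pairDet_self]; exact one_ne_zero

theorem cumDet_ne_zero {A : Flag k l} {B : DualFlag k l} (h : ∀ i < l, pairDet A B i ≠ 0)
    (i : ℕ) (hi : i ≤ l) : cumDet A B i ≠ 0 :=
  Finset.prod_ne_zero_iff.2 fun _ hr =>
    pairDet_ne_zero h _ ((Nat.succ_le_of_lt (Finset.mem_range.1 hr)).trans hi)

theorem det_mixedFrame_ne_zero {A : Flag k l} {B : DualFlag k l}
    (h : ∀ i < l, pairDet A B i ≠ 0) : (mixedFrame A B).det ≠ 0 := by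
  rw [det_mixedFrame h]; exact cumDet_ne_zero h l le_rfl

/-- An invariant function on tuples is determined by its values on normal forms. -/
theorem Z_eq_normalForm {m : ℕ} {F : Tup k l m → k} (hF : F ∈ Z k l m) (t : Tup k l m) (g : G k l)
    (h : ∀ i < l, pairDet t.1.1 (DualFlag.gMul g t.2) i ≠ 0) :
    let p := normalize _ (det_mixedFrame_ne_zero h)
    F t = F ((stdFlag (cumDet t.1.1 (DualFlag.gMul g t.2)),
      fun n => p⁻¹ * t.1.2 n * (g⁻¹ * p)),
      stdDual fun i => pairDet t.1.1 (DualFlag.gMul g t.2) i *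
        (cumDet t.1.1 (DualFlag.gMul g t.2) i)⁻¹) := by
  intro p
  set B := DualFlag.gMul g t.2 with hB
  have hlead := (adapted_mixedFrame t.1.1 B).det_leading (arrow_injective_of_pairDet h)
  have hc := cumDet_ne_zero h
  obtain ⟨σ, hσ, hσl⟩ := (adapted_mixedFrame t.1.1 B).exists_act_eq (d := cumDet t.1.1 B)
    hlead hc (det_mixedFrame_ne_zero h)
  obtain ⟨τ, hτ, hτl⟩ := exists_dual_act_eq (A := t.1.1) (B := B)
    (e := fun i => pairDet t.1.1 B i * (cumDet t.1.1 B i)⁻¹) (fun i hi => by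
      -- Since the leading determinant is `d_i`, the coframe has determinant `d_i / s_i`; its
      -- inverse is the parameter of the dual flag.
      have h1 := pairDet_mul_det_coframe t.1.1 B i hi
      rw [hlead] at h1
      change _ = pairDet t.1.1 B i * (∏ r ∈ Finset.range i, pairDet t.1.1 B (r + 1))⁻¹
      rw [← h1, mul_inv, ← mul_assoc, mul_inv_cancel₀ (pairDet_ne_zero h i hi), one_mul])
    (fun i hi => mul_ne_zero (pairDet_ne_zero h i hi) (inv_ne_zero (hc i hi)))
    (det_mixedFrame_ne_zero h)
  obtain ⟨s, hs⟩ := Flag.exists_gamma t.1.1 σ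
  obtain ⟨s', hs'⟩ := DualFlag.exists_gamma B τ
  -- This element of `G × G` sends `A` to `A p` and `Ǎ` to `p⁻¹ g Ǎ`, so both are normalized at the
  -- vertex `l`; the two elements of `SL_γ` finish the lower vertices.
  have h1 := hF.2 (p⁻¹, p⁻¹ * g) t
  have h2 := tups_invariant hF.1 s s' (Tup.act (p⁻¹, p⁻¹ * g) t)
  rw [← h1, ← h2]
  refine congrArg F (Prod.ext (Prod.ext ?_ ?_) ?_)
  · change Flag.act (Flag.mulG t.1.1 (p⁻¹)⁻¹) s.1 = stdFlag _
    rw [inv_inv, ← hσ, ← hs, hσl]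
  · funext n
    change p⁻¹ * t.1.2 n * (p⁻¹ * g)⁻¹ = _
    rw [_root_.mul_inv_rev, inv_inv]
  · have h3 : (Tup.act (p⁻¹, p⁻¹ * g) t).2 = DualFlag.gMul (p⁻¹ * g) t.2 := rfl
    dsimp only
    rw [h3, DualFlag.gMul_mul, ← hB, ← hτ, ← hs', hτl]

end NormalForm

/-! ### Preimages of the open sets -/

section OpenSets

variable {k : Type u} [Field k] {l : ℕ}

theorem Mor.spec_comp {P Q R : Type u} {X : AffVar k P} {Y : AffVar k Q} {W : AffVar k R}
    (ψ : Mor Y W) (φ : Mor X Y) : (ψ.comp φ).spec = φ.spec ≫ ψ.spec :=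
  Spec.map_comp (CommRingCat.ofHom ψ.comorphism.toRingHom)
    (CommRingCat.ofHom φ.comorphism.toRingHom)

theorem Mor.preimage_comp {P Q R : Type u} {X : AffVar k P} {Y : AffVar k Q} {W : AffVar k R}
    (ψ : Mor Y W) (φ : Mor X Y) (V : (FlaggedKronecker.spec W).Opens) :
    φ.spec ⁻¹ᵁ (ψ.spec ⁻¹ᵁ V) = (ψ.comp φ).spec ⁻¹ᵁ V := by
  rw [Mor.spec_comp]; rfl

/-- Morphisms to a quotient whose values lie in the same orbits are equal as morphisms of
schemes. -/
theorem Mor.spec_eq_of_orbit {P Q Γ : Type u} {X : AffVar k P} {Y : AffVar k Q}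
    {ρ : Γ → Q → Q} {φ ψ : Mor X (quotVar Y ρ)} (h : ∀ x, ∃ γ, φ.map x = ρ γ (ψ.map x)) :
    φ.spec = ψ.spec := by
  have : φ.comorphism = ψ.comorphism := by
    refine AlgHom.ext fun f => Subtype.ext (funext fun x => ?_)
    obtain ⟨γ, hγ⟩ := h x
    change f.1 (φ.map x) = f.1 (ψ.map x)
    rw [hγ, f.2.2]
  rw [Mor.spec, Mor.spec, this]

theorem piTilde_even {m j : ℕ} (hj : ¬ Even j) (t : Tup k l m) :
    (piTilde m (j + 1)).map t =
      ((Flag.mulG t.1.1 (altProd t.g j), Flag.mulG t.1.1 (t.g (j + 1))),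
        (DualFlag.gMul (revProd t.g (j + 1)) t.2, t.2)) := by
  rw [show piTilde (k := k) (l := l) m (j + 1) = piEven m (j + 1) from
    if_pos (Nat.even_add_one.2 hj)]
  rfl

theorem piTilde_odd {m j : ℕ} (hj : Even j) (t : Tup k l m) :
    (piTilde m (j + 1)).map t =
      ((Flag.mulG t.1.1 (altProd t.g j), t.1.1),
        (DualFlag.gMul (revProd t.g (j + 1)) t.2, DualFlag.gMul (t.g (j + 1)) t.2)) := by
  rw [show piTilde (k := k) (l := l) m (j + 1) = piOdd m (j + 1) from
    if_neg fun h => Nat.even_add_one.1 h hj]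
  rfl

theorem Flag.mulG_one (A : Flag k l) : Flag.mulG A 1 = A := by
  have h : (atLast (1 : G k l)) = 1 := Pi.mulSingle_one _
  rw [Flag.mulG, h, Flag.act_one]

theorem DualFlag.one_gMul (A : DualFlag k l) : DualFlag.gMul 1 A = A := by
  have h : (atLast (1 : G k l)) = 1 := Pi.mulSingle_one _
  rw [DualFlag.gMul, h, DualFlag.act_one]

theorem altProd_succ_even {Γ : Type u} [Group Γ] (g : ℕ → Γ) {j : ℕ} (hj : Even j) :
    altProd g (j + 1) = altProd g j * g (j + 1) := by rw [altProd, if_pos hj]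

theorem altProd_succ_odd {Γ : Type u} [Group Γ] (g : ℕ → Γ) {j : ℕ} (hj : ¬ Even j) :
    altProd g (j + 1) = altProd g j * (g (j + 1))⁻¹ := by rw [altProd, if_neg hj]

theorem revProd_succ_even {Γ : Type u} [Group Γ] (g : ℕ → Γ) {j : ℕ} (hj : Even j) :
    revProd g (j + 1) = g (j + 1) * revProd g j := by rw [revProd, if_pos hj]

theorem revProd_succ_odd {Γ : Type u} [Group Γ] (g : ℕ → Γ) {j : ℕ} (hj : ¬ Even j) :
    revProd g (j + 1) = (g (j + 1))⁻¹ * revProd g j := by rw [revProd, if_neg hj]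

variable (k l) in
/-- The conditions defining the open set of `Z` that belong to the index `n`. -/
def Zpiece {m n : ℕ} (h : n ≤ m) : (spec (Z k l m)).Opens :=
  if hn : Even n then
    (altFlagPair h hn).spec ⁻¹ᵁ generic20 k l ⊓ (revDualPair h hn).spec ⁻¹ᵁ generic02 k l
  else
    (altMixedPair h hn).spec ⁻¹ᵁ generic11 k l ⊓ (revMixedPair h hn).spec ⁻¹ᵁ generic11 k l

theorem Zopen_eq (m : ℕ) : Zopen k l m =
    ⨅ n : Finset.Icc 1 (m - 1), Zpiece k l (le_of_mem_Icc_pred n) := rfl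

variable {m j : ℕ} (hj : j + 1 ∈ Finset.Icc 2 m) (hm : j + 1 ≤ m)

include hm

/-- In this and the next seven identities the pair read off from `π_{j+1}` is the corresponding pair
on `Z`, translated by `1` or by `g_{j+1}^{±1}`. The parity in the names is that of `j + 1`. -/
theorem p14_comp_even (h : ¬ Even j) : ((p14 k l).comp (piMor k l m ⟨j + 1, hj⟩)).spec =
    (altMixedPair (Nat.le_of_succ_le hm) h).spec := by
  refine Mor.spec_eq_of_orbit fun t => ⟨1, ?_⟩
  change (((piTilde m (j + 1)).map t).1.1, ((piTilde m (j + 1)).map t).2.2) = _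
  rw [piTilde_even h, inv_one]
  exact Prod.ext (Flag.mulG_one _).symm (DualFlag.one_gMul _).symm

theorem p23_comp_even (h : ¬ Even j) : ((p23 k l).comp (piMor k l m ⟨j + 1, hj⟩)).spec =
    (revMixedPair (Nat.le_of_succ_le hm) h).spec := by
  refine Mor.spec_eq_of_orbit fun t => ⟨(t.g (j + 1))⁻¹, ?_⟩
  change (((piTilde m (j + 1)).map t).1.2, ((piTilde m (j + 1)).map t).2.1) = _
  rw [piTilde_even h, inv_inv]
  refine Prod.ext rfl ?_
  change DualFlag.gMul (revProd t.g (j + 1)) t.2 = DualFlag.gMul _ (DualFlag.gMul _ _)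
  rw [← DualFlag.gMul_mul, revProd_succ_odd _ h]
  rfl

theorem p12_comp_even (h : ¬ Even j) : ((p12 k l).comp (piMor k l m ⟨j + 1, hj⟩)).spec =
    (altFlagPair hm (Nat.even_add_one.2 h)).spec := by
  refine Mor.spec_eq_of_orbit fun t => ⟨(t.g (j + 1))⁻¹, ?_⟩
  change ((piTilde m (j + 1)).map t).1 = _
  rw [piTilde_even h, inv_inv]
  refine Prod.ext ?_ rfl
  change Flag.mulG t.1.1 (altProd t.g j) =
    Flag.mulG (Flag.mulG t.1.1 (altProd t.g (j + 1))) (t.g (j + 1))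
  rw [← Flag.mulG_mul, altProd_succ_odd _ h, inv_mul_cancel_right]

theorem p43_comp_even (h : ¬ Even j) : ((p43 k l).comp (piMor k l m ⟨j + 1, hj⟩)).spec =
    (revDualPair hm (Nat.even_add_one.2 h)).spec := by
  refine Mor.spec_eq_of_orbit fun t => ⟨1, ?_⟩
  change (((piTilde m (j + 1)).map t).2.2, ((piTilde m (j + 1)).map t).2.1) = _
  rw [piTilde_even h]
  exact Prod.ext (DualFlag.one_gMul _).symm (DualFlag.one_gMul _).symm

theorem p12_comp_odd (h : Even j) : ((p12 k l).comp (piMor k l m ⟨j + 1, hj⟩)).spec =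
    (altFlagPair (Nat.le_of_succ_le hm) h).spec := by
  refine Mor.spec_eq_of_orbit fun t => ⟨1, ?_⟩
  change ((piTilde m (j + 1)).map t).1 = _
  rw [piTilde_odd h, inv_one]
  exact Prod.ext (Flag.mulG_one _).symm (Flag.mulG_one _).symm

theorem p43_comp_odd (h : Even j) : ((p43 k l).comp (piMor k l m ⟨j + 1, hj⟩)).spec =
    (revDualPair (Nat.le_of_succ_le hm) h).spec := by
  refine Mor.spec_eq_of_orbit fun t => ⟨t.g (j + 1), ?_⟩
  change (((piTilde m (j + 1)).map t).2.2, ((piTilde m (j + 1)).map t).2.1) = _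
  rw [piTilde_odd h]
  refine Prod.ext rfl ?_
  change DualFlag.gMul (revProd t.g (j + 1)) t.2 = DualFlag.gMul _ (DualFlag.gMul _ _)
  rw [← DualFlag.gMul_mul, revProd_succ_even _ h]
  rfl

theorem p14_comp_odd (h : Even j) : ((p14 k l).comp (piMor k l m ⟨j + 1, hj⟩)).spec =
    (altMixedPair hm (fun h' => Nat.even_add_one.1 h' h)).spec := by
  refine Mor.spec_eq_of_orbit fun t => ⟨t.g (j + 1), ?_⟩
  change (((piTilde m (j + 1)).map t).1.1, ((piTilde m (j + 1)).map t).2.2) = _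
  rw [piTilde_odd h]
  refine Prod.ext ?_ rfl
  change Flag.mulG t.1.1 (altProd t.g j) =
    Flag.mulG (Flag.mulG t.1.1 (altProd t.g (j + 1))) (t.g (j + 1))⁻¹
  rw [← Flag.mulG_mul, altProd_succ_even _ h, mul_inv_cancel_right]

theorem p23_comp_odd (h : Even j) : ((p23 k l).comp (piMor k l m ⟨j + 1, hj⟩)).spec =
    (revMixedPair hm (fun h' => Nat.even_add_one.1 h' h)).spec := by
  refine Mor.spec_eq_of_orbit fun t => ⟨1, ?_⟩
  change (((piTilde m (j + 1)).map t).1.2, ((piTilde m (j + 1)).map t).2.1) = _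
  rw [piTilde_odd h, inv_one]
  exact Prod.ext (Flag.mulG_one _).symm (DualFlag.one_gMul _).symm

theorem piMor_preimage_circled : (piMor k l m ⟨j + 1, hj⟩).spec ⁻¹ᵁ X22circled k l (j + 1) =
    Zpiece k l (Nat.le_of_succ_le hm) := by
  by_cases h : Even j
  · rw [X22circled, if_neg (fun h' => Nat.even_add_one.1 h' h), preimage_inf, Mor.preimage_comp,
      Mor.preimage_comp, p12_comp_odd hj hm h, p43_comp_odd hj hm h, Zpiece, dif_pos h]
  · rw [X22circled, if_pos (Nat.even_add_one.2 h), preimage_inf, Mor.preimage_comp,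
      Mor.preimage_comp, p14_comp_even hj hm h, p23_comp_even hj hm h, Zpiece, dif_neg h]

theorem piMor_preimage_circ : (piMor k l m ⟨j + 1, hj⟩).spec ⁻¹ᵁ X22circ k l =
    Zpiece k l (Nat.le_of_succ_le hm) ⊓ Zpiece k l hm := by
  rw [X22circ, preimage_inf, preimage_inf, preimage_inf, Mor.preimage_comp, Mor.preimage_comp,
    Mor.preimage_comp, Mor.preimage_comp]
  by_cases h : Even j
  · rw [p12_comp_odd hj hm h, p43_comp_odd hj hm h, p14_comp_odd hj hm h, p23_comp_odd hj hm h,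
      Zpiece, dif_pos h, Zpiece, dif_neg (fun h' => Nat.even_add_one.1 h' h)]
    ac_rfl
  · rw [p14_comp_even hj hm h, p23_comp_even hj hm h, p12_comp_even hj hm h,
      p43_comp_even hj hm h, Zpiece, dif_neg h, Zpiece, dif_pos (Nat.even_add_one.2 h)]
    ac_rfl

omit hm hj

/-- The factor `π_{j+1}` gives the conditions for the indices `j` and `j + 1`, and the last factor
those for `m - 1` only; together they cover exactly `[1, m - 1]`. -/
theorem piMap_preimage_targetOpen (hm : 2 ≤ m) :
    (piMap k l m).spec ⁻¹ᵁ targetOpen k l m = Zopen k l m := by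
  have key : ∀ n : Finset.Icc 2 m, (piMap k l m).spec ⁻¹ᵁ
      ((Mor.proj (Finset.Icc 2 m) (X22 k l) n).spec ⁻¹ᵁ
        (if n.1 = m then X22circled k l m else X22circ k l)) =
      (piMor k l m n).spec ⁻¹ᵁ (if n.1 = m then X22circled k l m else X22circ k l) :=
    fun n => Mor.preimage_comp _ _ _
  rw [targetOpen, preimage_iInf, Zopen_eq]
  simp only [key]
  refine le_antisymm (le_iInf fun n => ?_) (le_iInf fun n => ?_)
  · have hn := Finset.mem_Icc.1 n.2
    have hmem : n.1 + 1 ∈ Finset.Icc 2 m := Finset.mem_Icc.2 (by omega)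
    -- The conditions of index `n` are visible in the factor `π_{n+1}`, whether or not it is the
    -- last one.
    refine (iInf_le _ ⟨n.1 + 1, hmem⟩).trans ?_
    split_ifs with h
    · rw [← congrArg (X22circled k l) h, piMor_preimage_circled hmem (by omega)]
    · rw [piMor_preimage_circ hmem (by omega)]
      exact inf_le_left
  · have hn := Finset.mem_Icc.1 n.2
    obtain ⟨n, hmem⟩ := n
    obtain ⟨j, rfl⟩ : ∃ j, n = j + 1 := ⟨n - 1, by dsimp only at hn; omega⟩
    dsimp only at hn ⊢
    have h1 : ⨅ n : Finset.Icc 1 (m - 1), Zpiece k l (le_of_mem_Icc_pred n) ≤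
        Zpiece k l (show j ≤ m by omega) :=
      iInf_le (fun n : Finset.Icc 1 (m - 1) => Zpiece k l (le_of_mem_Icc_pred n))
        ⟨j, Finset.mem_Icc.2 (by omega)⟩
    split_ifs with h
    · rw [← congrArg (X22circled k l) h, piMor_preimage_circled hmem (by omega)]
      exact h1
    · rw [piMor_preimage_circ hmem (by omega)]
      exact le_inf h1 (iInf_le (fun n : Finset.Icc 1 (m - 1) => Zpiece k l (le_of_mem_Icc_pred n))
        ⟨j + 1, Finset.mem_Icc.2 (by omega)⟩)

theorem exists_principal_targetOpen (m : ℕ) :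
    ∃ h, targetOpen k l m = principal (target k l m) h := by
  have h20 : ∃ f, generic20 k l = principal (X20 k l) f :=
    exists_principal_iInf fun p => ⟨s20 p, rfl⟩
  have h11 : ∃ f, generic11 k l = principal (X11 k l) f :=
    exists_principal_iInf fun p => ⟨s11 p, rfl⟩
  have h02 : ∃ f, generic02 k l = principal (X02 k l) f :=
    exists_principal_iInf fun p => ⟨s02 p, rfl⟩
  refine exists_principal_iInf fun n => exists_principal_preimage _ ?_
  split_ifs
  · rw [X22circled]
    split_ifs
    · exact exists_principal_inf (exists_principal_preimage _ h11)
        (exists_principal_preimage _ h11)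
    · exact exists_principal_inf (exists_principal_preimage _ h20)
        (exists_principal_preimage _ h02)
  · exact exists_principal_inf
      (exists_principal_inf (exists_principal_preimage _ h20) (exists_principal_preimage _ h11))
      (exists_principal_inf (exists_principal_preimage _ h11) (exists_principal_preimage _ h02))

end OpenSets

/-! ### The chain of frames and the normal form over the localized algebra -/

section Chain

variable {k : Type u} [Field k] {l m : ℕ}

/-- A determinant whose non-vanishing is part of the defining condition becomes a unit after
inverting `h`. -/
theorem invMem_of_principal_le {P Q R : Type u} {X : AffVar k P} {Y : AffVar k Q}
    {W : AffVar k R} (φ : Mor X Y) {h : Y} (χ : Mor Y W) {ι : Type} {s : ι → W}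
    (hle : principal Y h ≤ χ.spec ⁻¹ᵁ ⨅ i, principal W (s i)) (i : ι) :
    InvMem (pullbackAlg φ h) fun x => (s i).1 (χ.map (φ.map x.1)) := by
  have h1 : principal Y h ≤ principal Y (χ.comorphism (s i)) :=
    hle.trans (Scheme.Hom.preimage_mono χ.spec (iInf_le _ i))
  have h2 := pullback_inv_mem (φ := φ) h1
  exact ⟨h2.2, pullback_mem (χ.comorphism (s i)), h2.1⟩

/-- The algebra of functions on the locus `h ≠ 0` obtained from `target k l m` by localization. -/
abbrev locAlg (h : target k l m) : AffVar k (Locus (piMap k l m) h) := pullbackAlg (piMap k l m) h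

/-- The map `π_n` on the locus `h ≠ 0`. -/
def locusMor (h : target k l m) (n : Finset.Icc 2 m) : Mor (locAlg h) (X22 k l) where
  map t := (piTilde m n).map t.1
  regular f hf := pullback_mem (φ := piMap k l m)
    ((Mor.proj (Finset.Icc 2 m) (X22 k l) n).comorphism ⟨f, hf⟩)

theorem p14_comp_locusMor (h : target k l m) (n : Finset.Icc 2 m) (x : Locus (piMap k l m) h) :
    ((p14 k l).comp (locusMor h n)).map x =
      (((piTilde m n).map x.1).1.1, ((piTilde m n).map x.1).2.2) := rfl

/-- The frames on the left side of the tuple. -/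
def leftFrame (t : Tup k l m) (n : ℕ) : Matrix (Fin l) (Fin l) k :=
  if Even n then flagFrame (Flag.mulG t.1.1 (altProd t.g n)) t.1.1
  else mixedFrame t.1.1 (DualFlag.gMul (revProd t.g n) t.2)

/-- The frames on the right side of the tuple. -/
def rightFrame (t : Tup k l m) (n : ℕ) : Matrix (Fin l) (Fin l) k :=
  if Even n then dualFrame t.2 (DualFlag.gMul (revProd t.g n) t.2)
  else mixedFrame (Flag.mulG t.1.1 (altProd t.g n)) t.2

section Even

variable {j : ℕ} (hj : ¬ Even j) (t : Tup k l m)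

include hj

/-- This group and the odd one express the four frames of the quadruple `π_{j+1}(t)` as the left and
right frames of index `j` and `j + 1`, up to left multiplication by `g_{j+1}`. -/
theorem mixed14_even : mixedFrame ((piTilde m (j + 1)).map t).1.1
    ((piTilde m (j + 1)).map t).2.2 = rightFrame t j := by
  rw [piTilde_even hj, rightFrame, if_neg hj]

theorem mixed23_even : SLmat (t.g (j + 1)) * mixedFrame ((piTilde m (j + 1)).map t).1.2
    ((piTilde m (j + 1)).map t).2.1 = leftFrame t j := by
  rw [piTilde_even hj, leftFrame, if_neg hj, ← mixedFrame_gMul, ← Flag.mulG_mul,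
    ← DualFlag.gMul_mul, mul_inv_cancel, Flag.mulG_one, revProd_succ_odd _ hj,
    mul_inv_cancel_left]

theorem flag12_even : SLmat (t.g (j + 1)) * flagFrame ((piTilde m (j + 1)).map t).1.1
    ((piTilde m (j + 1)).map t).1.2 = leftFrame t (j + 1) := by
  rw [piTilde_even hj, leftFrame, if_pos (Nat.even_add_one.2 hj), ← flagFrame_mulG,
    ← Flag.mulG_mul, ← Flag.mulG_mul, mul_inv_cancel, Flag.mulG_one, altProd_succ_odd _ hj]

theorem dual43_even : dualFrame ((piTilde m (j + 1)).map t).2.2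
    ((piTilde m (j + 1)).map t).2.1 = rightFrame t (j + 1) := by
  rw [piTilde_even hj, rightFrame, if_pos (Nat.even_add_one.2 hj)]

end Even

section Odd

variable {j : ℕ} (hj : Even j) (t : Tup k l m)

include hj

theorem flag12_odd : flagFrame ((piTilde m (j + 1)).map t).1.1
    ((piTilde m (j + 1)).map t).1.2 = leftFrame t j := by
  rw [piTilde_odd hj, leftFrame, if_pos hj]

theorem mixed23_odd : mixedFrame ((piTilde m (j + 1)).map t).1.2
    ((piTilde m (j + 1)).map t).2.1 = leftFrame t (j + 1) := by
  rw [piTilde_odd hj, leftFrame, if_neg fun h => Nat.even_add_one.1 h hj]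

theorem mixed14_odd : mixedFrame ((piTilde m (j + 1)).map t).1.1
    ((piTilde m (j + 1)).map t).2.2 = SLmat (t.g (j + 1)) * rightFrame t (j + 1) := by
  rw [piTilde_odd hj, rightFrame, if_neg fun h => Nat.even_add_one.1 h hj, ← mixedFrame_gMul,
    ← Flag.mulG_mul, altProd_succ_even _ hj, mul_inv_cancel_right]

theorem dual43_odd : dualFrame ((piTilde m (j + 1)).map t).2.2
    ((piTilde m (j + 1)).map t).2.1 = SLmat (t.g (j + 1)) * rightFrame t j := by
  rw [piTilde_odd hj, rightFrame, if_pos hj, ← dualFrame_gMul, ← DualFlag.gMul_mul,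
    revProd_succ_even _ hj]

end Odd

section Generic

variable {h : target k l m} (n : Finset.Icc 2 m)

theorem invMem_mixed14 (H : principal (target k l m) h ≤
    (Mor.proj (Finset.Icc 2 m) (X22 k l) n).spec ⁻¹ᵁ ((p14 k l).spec ⁻¹ᵁ generic11 k l)) :
    InvMem (locAlg h) fun x => (mixedFrame ((piTilde m n).map x.1).1.1
      ((piTilde m n).map x.1).2.2).det := by
  rw [Mor.preimage_comp] at H
  exact invMem_det_mixedFrame ((p14 k l).comp (locusMor h n))
    (invMem_of_principal_le (piMap k l m) _ H)

theorem invMem_mixed23 (H : principal (target k l m) h ≤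
    (Mor.proj (Finset.Icc 2 m) (X22 k l) n).spec ⁻¹ᵁ ((p23 k l).spec ⁻¹ᵁ generic11 k l)) :
    InvMem (locAlg h) fun x => (mixedFrame ((piTilde m n).map x.1).1.2
      ((piTilde m n).map x.1).2.1).det := by
  rw [Mor.preimage_comp] at H
  exact invMem_det_mixedFrame ((p23 k l).comp (locusMor h n))
    (invMem_of_principal_le (piMap k l m) _ H)

theorem invMem_flag12 (H : principal (target k l m) h ≤
    (Mor.proj (Finset.Icc 2 m) (X22 k l) n).spec ⁻¹ᵁ ((p12 k l).spec ⁻¹ᵁ generic20 k l)) :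
    InvMem (locAlg h) fun x => (flagFrame ((piTilde m n).map x.1).1.1
      ((piTilde m n).map x.1).1.2).det := by
  rw [Mor.preimage_comp] at H
  exact invMem_det_flagFrame ((p12 k l).comp (locusMor h n))
    (invMem_of_principal_le (piMap k l m) _ H)

theorem invMem_dual43 (H : principal (target k l m) h ≤
    (Mor.proj (Finset.Icc 2 m) (X22 k l) n).spec ⁻¹ᵁ ((p43 k l).spec ⁻¹ᵁ generic02 k l)) :
    InvMem (locAlg h) fun x => (dualFrame ((piTilde m n).map x.1).2.2
      ((piTilde m n).map x.1).2.1).det := by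
  rw [Mor.preimage_comp] at H
  exact invMem_det_dualFrame ((p43 k l).comp (locusMor h n))
    (invMem_of_principal_le (piMap k l m) _ H)

/-- `X_{2,2}^∘` imposes the genericity conditions of both parities, so every factor, and not only
the last, satisfies those of its own index. -/
theorem le_proj_circled (H : principal (target k l m) h ≤ targetOpen k l m) :
    principal (target k l m) h ≤
      (Mor.proj (Finset.Icc 2 m) (X22 k l) n).spec ⁻¹ᵁ X22circled k l n.1 := by
  refine (H.trans (iInf_le _ n)).trans (Scheme.Hom.preimage_mono _ ?_)
  split_ifs with hn
  · rw [hn]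
  · rw [X22circled]
    split_ifs
    · exact le_inf (inf_le_left.trans inf_le_right) (inf_le_right.trans inf_le_left)
    · exact le_inf (inf_le_left.trans inf_le_left) (inf_le_right.trans inf_le_right)

theorem le_proj_circ (H : principal (target k l m) h ≤ targetOpen k l m) (hn : n.1 ≠ m) :
    principal (target k l m) h ≤
      (Mor.proj (Finset.Icc 2 m) (X22 k l) n).spec ⁻¹ᵁ X22circ k l := by
  refine (H.trans (iInf_le _ n)).trans (Scheme.Hom.preimage_mono _ ?_)
  rw [if_neg hn]

end Generic

variable {h : target k l m} (H : principal (target k l m) h ≤ targetOpen k l m)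

include H

/-- The conditions common to all factors, including the last, suffice to compare the two sides of
the chain through `g_{j+1}`. -/
theorem transfer_across {j : ℕ} (h1 : 1 ≤ j) (hm : j + 1 ≤ m) :
    Transfer (locAlg h) (fun x => leftFrame x.1 j)
      (fun x => SLmat (x.1.g (j + 1)) * rightFrame x.1 j) := by
  have hmem : j + 1 ∈ Finset.Icc 2 m := Finset.mem_Icc.2 (by omega)
  have hc := le_proj_circled ⟨j + 1, hmem⟩ H
  rw [X22circled] at hc
  by_cases hj : Even j
  · rw [if_neg fun h => Nat.even_add_one.1 h hj] at hc
    simp only [← flag12_odd hj, ← dual43_odd hj]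
    exact isFrame_flag12.transfer isFrame_dual43 (locusMor h ⟨j + 1, hmem⟩)
      (invMem_flag12 _ (hc.trans (Scheme.Hom.preimage_mono _ inf_le_left)))
  · rw [if_pos (Nat.even_add_one.2 hj)] at hc
    simp only [← mixed23_even hj, ← mixed14_even hj]
    exact (isFrame_mixed23.transfer isFrame_mixed14 (locusMor h ⟨j + 1, hmem⟩)
      (invMem_mixed23 _ (hc.trans (Scheme.Hom.preimage_mono _ inf_le_right)))).mul_left _

theorem transfer_left {j : ℕ} (h1 : 1 ≤ j) (hm : j + 1 < m) :
    Transfer (locAlg h) (fun x => leftFrame x.1 j) (fun x => leftFrame x.1 (j + 1)) := by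
  have hmem : j + 1 ∈ Finset.Icc 2 m := Finset.mem_Icc.2 (by omega)
  have hc := le_proj_circ ⟨j + 1, hmem⟩ H hm.ne
  by_cases hj : Even j
  · simp only [← flag12_odd hj, ← mixed23_odd hj]
    exact isFrame_flag12.transfer isFrame_mixed23 (locusMor h ⟨j + 1, hmem⟩)
      (invMem_flag12 _ (hc.trans (Scheme.Hom.preimage_mono _ (inf_le_left.trans inf_le_left))))
  · simp only [← mixed23_even hj, ← flag12_even hj]
    exact (isFrame_mixed23.transfer isFrame_flag12 (locusMor h ⟨j + 1, hmem⟩)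
      (invMem_mixed23 _ (hc.trans (Scheme.Hom.preimage_mono _ (inf_le_right.trans inf_le_left))))).mul_left _

/-- The index decreases here and increases in `transfer_left`: the chain runs out along the left
frames, crosses by `g_n`, and returns along the right frames. -/
theorem transfer_right {j : ℕ} (h1 : 1 ≤ j) (hm : j + 1 < m) :
    Transfer (locAlg h) (fun x => rightFrame x.1 (j + 1)) (fun x => rightFrame x.1 j) := by
  have hmem : j + 1 ∈ Finset.Icc 2 m := Finset.mem_Icc.2 (by omega)
  have hc := le_proj_circ ⟨j + 1, hmem⟩ H hm.ne
  by_cases hj : Even j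
  · refine Transfer.of_mul_left (fun x => x.1.g (j + 1)) ?_
    simp only [← mixed14_odd hj, ← dual43_odd hj]
    exact isFrame_mixed14.transfer isFrame_dual43 (locusMor h ⟨j + 1, hmem⟩)
      (invMem_mixed14 _ (hc.trans (Scheme.Hom.preimage_mono _ (inf_le_left.trans inf_le_right))))
  · simp only [← dual43_even hj, ← mixed14_even hj]
    exact isFrame_dual43.transfer isFrame_mixed14 (locusMor h ⟨j + 1, hmem⟩)
      (invMem_dual43 _ (hc.trans (Scheme.Hom.preimage_mono _ (inf_le_right.trans inf_le_right))))

theorem transfer_chain {j : ℕ} (h1 : 1 ≤ j) (hm : j < m) :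
    Transfer (locAlg h) (fun x => leftFrame x.1 1) (fun x => leftFrame x.1 j) ∧
      Transfer (locAlg h) (fun x => rightFrame x.1 j) (fun x => rightFrame x.1 1) := by
  induction j, h1 using Nat.le_induction with
  | base => exact ⟨Transfer.refl, Transfer.refl⟩
  | succ j h1 ih =>
    obtain ⟨hl, hr⟩ := ih (by omega)
    exact ⟨hl.trans (transfer_left H h1 hm), (transfer_right H h1 hm).trans hr⟩

omit H

theorem leftFrame_one (t : Tup k l m) :
    leftFrame t 1 = mixedFrame t.1.1 (DualFlag.gMul (t.g 1) t.2) := by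
  rw [leftFrame, if_neg Nat.not_even_one, revProd_succ_even _ Even.zero, revProd, mul_one]

theorem rightFrame_one (t : Tup k l m) :
    SLmat (t.g 1) * rightFrame t 1 = leftFrame t 1 := by
  rw [leftFrame_one, rightFrame, if_neg Nat.not_even_one, ← mixedFrame_gMul, ← Flag.mulG_mul,
    altProd_succ_even _ Even.zero, altProd, one_mul, mul_inv_cancel, Flag.mulG_one]

include H

theorem transfer_group {n : ℕ} (h1 : 1 ≤ n) (hm : n ≤ m) :
    Transfer (locAlg h) (fun x => leftFrame x.1 1)
      (fun x => SLmat (x.1.g n) * rightFrame x.1 1) := by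
  rcases h1.eq_or_lt with rfl | h2
  · simp only [rightFrame_one]
    exact Transfer.refl
  · obtain ⟨j, rfl⟩ : ∃ j, n = j + 1 := ⟨n - 1, by omega⟩
    have hc := transfer_chain H (show 1 ≤ j by omega) (show j < m by omega)
    exact (hc.1.trans (transfer_across H (by omega) hm)).trans (hc.2.mul_left _)

theorem invMem_pairDet_one (hm : 2 ≤ m) (i : ℕ) (hi : i ≤ l) :
    InvMem (locAlg h) fun x => pairDet x.1.1.1 (DualFlag.gMul (x.1.g 1) x.1.2) i := by
  have hmem : 1 + 1 ∈ Finset.Icc 2 m := Finset.mem_Icc.2 (by omega)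
  have hc := le_proj_circled ⟨1 + 1, hmem⟩ H
  -- The factor `π_2` has even index, so `(A g_1, Ǎ)` is generic for every `m ≥ 2`; its pairings
  -- equal those of `(A, g_1 Ǎ)`.
  rw [X22circled, if_pos (Nat.even_add_one.2 Nat.not_even_one)] at hc
  have hc' := hc.trans (Scheme.Hom.preimage_mono _ inf_le_left)
  rw [Mor.preimage_comp] at hc'
  have h1 := invMem_pairDet ((p14 k l).comp (locusMor h ⟨1 + 1, hmem⟩))
    (invMem_of_principal_le (piMap k l m) _ hc') i hi
  convert h1 using 2 with x
  rw [p14_comp_locusMor, piTilde_even Nat.not_even_one]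
  rcases hi.lt_or_eq with hi | rfl
  · dsimp only
    rw [pairDet_of_lt _ _ ⟨i, hi⟩, pairDet_of_lt _ _ ⟨i, hi⟩,
      ← pairing_act ⟨i, hi⟩ (Flag.mulG x.1.1.1 (altProd x.1.g 1)) x.1.2 (x.1.g 1), ← Flag.mulG_mul, altProd_succ_even _ Even.zero, altProd, one_mul, mul_inv_cancel,
      Flag.mulG_one]
  · rw [pairDet_self, pairDet_self]

/-- `F` is evaluated at the normal form: its coordinates depend on the tuple only through elements
of `locAlg h`, so they define a morphism along which `F` can be pulled back. -/
theorem restrict_mem_locAlg (hm : 2 ≤ m) (F : Z k l m) :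
    (fun x : Locus (piMap k l m) h => F.1 x.1) ∈ locAlg h := by
  have hs := invMem_pairDet_one H hm
  have hd : ∀ i ≤ l, InvMem (locAlg h)
      fun x => cumDet x.1.1.1 (DualFlag.gMul (x.1.g 1) x.1.2) i := fun i hi =>
    InvMem.prod fun r hr => hs _ ((Nat.succ_le_of_lt (Finset.mem_range.1 hr)).trans hi)
  have hne : ∀ (x : Locus (piMap k l m) h), ∀ i < l,
      pairDet x.1.1.1 (DualFlag.gMul (x.1.g 1) x.1.2) i ≠ 0 := fun x i hi => (hs i hi.le).1 x
  have hdiag : ∀ (i : ℕ) (c : Locus (piMap k l m) h → k), c ∈ locAlg h → ∀ a b,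
      (fun x => lastDiag i (c x) a b) ∈ locAlg h := by
    intro i c hc a b
    simp only [lastDiag, Matrix.diagonal_apply]
    split_ifs
    · exact hc
    · exact (locAlg h).one_mem
    · exact (locAlg h).zero_mem
  have hdet : ∀ x : Locus (piMap k l m) h,
      (mixedFrame x.1.1.1 (DualFlag.gMul (x.1.g 1) x.1.2)).det =
        cumDet x.1.1.1 (DualFlag.gMul (x.1.g 1) x.1.2) l := fun x => det_mixedFrame (hne x)
  let p : Locus (piMap k l m) h → G k l := fun x =>
    normalize _ (det_mixedFrame_ne_zero (hne x))
  have hp : ∀ x, SLmat (p x) = leftFrame x.1 1 *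
      lastDiag l (cumDet x.1.1.1 (DualFlag.gMul (x.1.g 1) x.1.2) l)⁻¹ := by
    intro x
    rw [SLmat_normalize, hdet, leftFrame_one]
  let flagPart : Mor (locAlg h) (flags k l) :=
    ⟨fun x => stdFlag (cumDet x.1.1.1 (DualFlag.gMul (x.1.g 1) x.1.2)), fun f hf => by
      refine Mor.coordVar_regular (X := locAlg h) (φ := fun x : Locus (piMap k l m) h =>
        stdFlag (cumDet x.1.1.1 (DualFlag.gMul (x.1.g 1) x.1.2))) ?_ f hf.1
      rintro ⟨i, a, b⟩
      exact mul_entry_mem (N := fun _ => incl k i) (hdiag _ _ (hd _ i.2.le).2.1)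
        (fun _ _ => Subalgebra.algebraMap_mem _ _) a b⟩
  let dualPart : Mor (locAlg h) (dualFlags k l) :=
    ⟨fun x => stdDual fun i => pairDet x.1.1.1 (DualFlag.gMul (x.1.g 1) x.1.2) i *
        (cumDet x.1.1.1 (DualFlag.gMul (x.1.g 1) x.1.2) i)⁻¹, fun f hf => by
      refine Mor.coordVar_regular (X := locAlg h) (φ := fun x : Locus (piMap k l m) h =>
        stdDual fun i => pairDet x.1.1.1 (DualFlag.gMul (x.1.g 1) x.1.2) i *
          (cumDet x.1.1.1 (DualFlag.gMul (x.1.g 1) x.1.2) i)⁻¹) ?_ f hf.1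
      rintro ⟨i, a, b⟩
      exact mul_entry_mem (M := fun _ => (incl k i)ᵀ)
        (fun _ _ => Subalgebra.algebraMap_mem _ _)
        (hdiag _ _ (Subalgebra.mul_mem _ (hs _ i.2.le).2.1 (hd _ i.2.le).2.2)) a b⟩
  -- As `p` is `L_1` times a diagonal matrix and `g_1⁻¹ L_1 = R_1`, the normalized group element is
  -- `L_1⁻¹ g_n R_1` conjugated by that diagonal matrix.
  have hgroup : ∀ (n : Finset.Icc 1 m) (a b : Fin l),
      (fun x : Locus (piMap k l m) h =>
        SLmat ((p x)⁻¹ * x.1.1.2 n * ((x.1.g 1)⁻¹ * p x)) a b) ∈ locAlg h := by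
    intro n
    obtain ⟨C, hC, hC'⟩ := transfer_group H (Finset.mem_Icc.1 n.2).1 (Finset.mem_Icc.1 n.2).2
    have key : ∀ x : Locus (piMap k l m) h,
        SLmat ((p x)⁻¹ * x.1.1.2 n * ((x.1.g 1)⁻¹ * p x)) =
          lastDiag l (cumDet x.1.1.1 (DualFlag.gMul (x.1.g 1) x.1.2) l) * C x *
            lastDiag l (cumDet x.1.1.1 (DualFlag.gMul (x.1.g 1) x.1.2) l)⁻¹ := by
      intro x
      have h1 : x.1.1.2 n = x.1.g n := by
        rw [Tup.g, dif_pos n.2]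
      have h2 : leftFrame x.1 1 = SLmat (p x) *
          lastDiag l (cumDet x.1.1.1 (DualFlag.gMul (x.1.g 1) x.1.2) l) := by
        rw [hp, Matrix.mul_assoc, lastDiag_inv_mul l ((hd l le_rfl).1 x), Matrix.mul_one]
      have h3 : SLmat (x.1.g n) * rightFrame x.1 1 = leftFrame x.1 1 * C x := hC' x
      rw [h2] at h3
      have h4 : rightFrame x.1 1 = SLmat (x.1.g 1)⁻¹ * leftFrame x.1 1 := by
        rw [← rightFrame_one, ← Matrix.mul_assoc, SL_inv_mul, Matrix.one_mul]
      rw [h1, SLmat_mul, SLmat_mul, SLmat_mul]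
      conv_lhs => rw [hp x]
      rw [← Matrix.mul_assoc (SLmat (x.1.g 1)⁻¹), ← h4, Matrix.mul_assoc (SLmat (p x)⁻¹),
        ← Matrix.mul_assoc (SLmat (x.1.g n)), h3]
      simp only [← Matrix.mul_assoc, SL_inv_mul, Matrix.one_mul]
    simp only [key]
    exact mul_entry_mem (mul_entry_mem (hdiag _ _ (hd _ le_rfl).2.1) hC)
      (hdiag _ _ (hd _ le_rfl).2.2)
  let groupPart : Mor (locAlg h) (powVar (Finset.Icc 1 m) (groupVar k l)) :=
    Mor.lift fun n => ⟨fun x => (p x)⁻¹ * x.1.1.2 n * ((x.1.g 1)⁻¹ * p x),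
      Mor.coordVar_regular fun c => hgroup n c.1 c.2⟩
  have := (Mor.pair (Mor.pair flagPart groupPart) dualPart).regular F.1 F.2.1
  convert this using 2 with x
  exact Z_eq_normalForm F.2 x.1 (x.1.g 1) (hne x)

end Chain

end FlaggedKronecker

end

/-- The restriction of `π = (π_2, …, π_m)` to `(Z_{l,l}^m)^∘_π` is a closed embedding into
`(X_{2,2}^∘)^{m-2} × X_{2,2}^{ⓜ}`. -/
theorem mainTheorem5 (k : Type u) [Field k] [IsAlgClosed k] [CharZero k] (l m : ℕ)
    (hl : 1 ≤ l) (hm : 2 ≤ m) :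
    ∃ h : FlaggedKronecker.Zopen k l m ≤
        (FlaggedKronecker.piMap k l m).spec ⁻¹ᵁ FlaggedKronecker.targetOpen k l m,
      IsClosedImmersion ((FlaggedKronecker.piMap k l m).spec.resLE
        (FlaggedKronecker.targetOpen k l m) (FlaggedKronecker.Zopen k l m) h) := by
  have hZ := FlaggedKronecker.piMap_preimage_targetOpen (k := k) (l := l) hm
  obtain ⟨h, hh⟩ := FlaggedKronecker.exists_principal_targetOpen (k := k) (l := l) m
  exact ⟨hZ.ge, FlaggedKronecker.isClosedImmersion_of_pullback_surjective _ hZ.ge hZ.le h hh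
    fun F => FlaggedKronecker.exists_pullback_eq F
      (FlaggedKronecker.restrict_mem_locAlg hh.ge hm F)⟩
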